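/- Let $\mathcal{H}$ be a complex Hilbert space of finite dimension $d\ge 1$, and let $\mathcal{P}=(\mathcal{P}_t)_{t\ge0}$ be a continuous quantum Markov semigroup on $\mathcal{B}(\mathcal{H})$, i.e. a continuous one-parameter semigroup of completely positive unital linear maps with $\mathcal{P}_0=\mathrm{id}$. Let $\mathcal{L}(X)=\lim_{t\to0^+}\frac1t(\mathcal{P}_t(X)-X)$ be its generator, and write $\Phi_*$ for the predual of a linear map $\Phi$, $\operatorname{Tr}[\Phi(X)Y]=\operatorname{Tr}[X\Phi_*(Y)]$; so $\mathcal{L}_*$ is the generator of $(\mathcal{P}_{t*})_{t\ge 0}$. A state is a matrix $\rho\ge0$ with $\operatorname{Tr}\rho=1$. Assume that $\mathcal{P}$ has a faithful invariant state. Let $$\mathcal{N}(\mathcal{P})=\{X:\ \mathcal{P}_t(X^*Y)=\mathcal{P}_t(X)^*\mathcal{P}_t(Y)\ \text{and}\ \mathcal{P}_t(YX^*)=\mathcal{P}_t(Y)\mathcal{P}_t(X)^*\ \ \forall t\ge0,\ \forall Y\}$$ be the decoherence-free algebra, and let $E_{\mathcal N}$ be the conditional expectation onto it: the (unique) completely positive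 projection with image $\mathcal{N}(\mathcal{P})$ and kernel $\{X:\lim_{t\to\infty}\mathcal{P}_t(X)=0\}$, which preserves every faithful invariant state. Put $\sigma_{\operatorname{Tr}}=E_{\mathcal N*}(I/d)$ (a faithful invariant state), and $$\mathcal{E}_{\mathcal L}(X)=-\operatorname{Tr}\big[\sigma_{\operatorname{Tr}}^{1/2}X^*\sigma_{\operatorname{Tr}}^{1/2}\mathcal{L}(X)\big],\qquad \operatorname{EP}_{\mathcal L}(\rho)=-\operatorname{Tr}\big[\mathcal{L}_*(\rho)(\log\rho-\log\sigma_{\operatorname{Tr}})\big],$$ where, for a singular state $\rho$, the entropy production takes the value $+\infty$ if the compression of $\mathcal{L}_*(\rho)$ to $\ker\rho$ (which is positive semidefinite) is nonzero, and is otherwise given by the formula with $\log\rho$ taken on the support of $\rho$. Assume that $\mathcal{P}$ is $\sigma_{\operatorname{Tr}}$-DBC: for all $X,Y\in\mathcal{B}(\mathcal{H})$ and all $t\ge0$, $$\operatorname{Tr}[\sigma_{\operatorname{Tr}}X^*\mathcal{P}_t(Y)]=\operatorname{Tr}[\sigma_{\operatorname{Tr}}\mathcal{P}_t(X^*)Y].$$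 Then every state $\rho$ satisfies $$\operatorname{EP}_{\mathcal L}(\rho)\ \ge\ 4\,\mathcal{E}_{\mathcal L}\big(\sigma_{\operatorname{Tr}}^{-1/4}\rho^{1/2}\sigma_{\operatorname{Tr}}^{-1/4}\big).$$ In particular $\mathcal{P}$ is $\mathbb{L}_1$-regular, i.e. $\operatorname{EP}_{\mathcal L}(\rho)\ge 2\,\mathcal{E}_{\mathcal L}(\sigma_{\operatorname{Tr}}^{-1/4}\rho^{1/2}\sigma_{\operatorname{Tr}}^{-1/4})$ for every state $\rho$; and, for every state $\rho$, $\operatorname{EP}_{\mathcal L}(\rho)=0$ if and only if $\rho=E_{\mathcal N*}(\rho)$. -/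

import Mathlib

open Filter Topology
open scoped NNReal Matrix ComplexOrder

namespace QuantumSemigroup

variable {n : Type*} [Fintype n] [DecidableEq n]

/-- Complete positivity of a linear map `Φ` on the algebra of `n × n` matrices: for every `k`, applying `Φ`
to each block of a positive semidefinite `k × k` block matrix gives a positive semidefinite matrix. -/
def IsCompletelyPositive (Φ : Matrix n n ℂ →ₗ[ℂ] Matrix n n ℂ) : Prop :=
  ∀ (k : ℕ) (M : Matrix (Fin k) (Fin k) (Matrix n n ℂ)),
    (Matrix.comp (Fin k) (Fin k) n n ℂ M).PosSemidef →
      (Matrix.comp (Fin k) (Fin k) n n ℂ (M.map Φ)).PosSemidef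

/-- A density matrix. -/
structure IsState (ρ : Matrix n n ℂ) : Prop where
  posSemidef : ρ.PosSemidef
  trace_eq_one : ρ.trace = 1

/-- The predual `Φ_*` of `Φ`, determined by `Tr[Φ(X) Y] = Tr[X Φ_*(Y)]` (see `trace_predual`).
Its `(i, j)` entry is `Tr[Φ(e_{ji}) Y]`, where `e_{ji}` is the matrix unit. -/
noncomputable def predual (Φ : Matrix n n ℂ →ₗ[ℂ] Matrix n n ℂ) :
    Matrix n n ℂ →ₗ[ℂ] Matrix n n ℂ where
  toFun Y := Matrix.of fun i j => (Φ (Matrix.single j i 1) * Y).trace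
  map_add' Y Z := by
    ext i j
    simp [mul_add]
  map_smul' c Y := by
    ext i j
    simp

theorem trace_predual (Φ : Matrix n n ℂ →ₗ[ℂ] Matrix n n ℂ) (X Y : Matrix n n ℂ) :
    (Φ X * Y).trace = (X * predual Φ Y).trace := by
  conv_lhs => rw [Matrix.matrix_eq_sum_single X]
  simp only [map_sum, Finset.sum_mul, Matrix.trace_sum]
  have key : ∀ i j, (Φ (Matrix.single i j (X i j)) * Y).trace = X i j * predual Φ Y j i := by
    intro i j
    have h : Matrix.single i j (X i j) = X i j • (Matrix.single i j 1 : Matrix n n ℂ) := by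
      simp
    rw [h, map_smul]
    simp [predual]
  simp only [key]
  simp [Matrix.trace, Matrix.mul_apply]

/-- Real powers `A ^ r` of a positive semidefinite matrix, by functional calculus. -/
noncomputable def mpow (A : Matrix n n ℂ) (r : ℝ) : Matrix n n ℂ :=
  cfc (fun x : ℝ => x ^ r) A

/-- The logarithm of a positive semidefinite matrix, taken on its support (it is `0` on the kernel). -/
noncomputable def mlog (A : Matrix n n ℂ) : Matrix n n ℂ :=
  cfc Real.log A

/-- The generator `X ↦ lim_{t → 0⁺} (T_t(X) - X) / t` of a one-parameter semigroup of linear maps. -/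
noncomputable def generator (T : ℝ≥0 → Matrix n n ℂ →ₗ[ℂ] Matrix n n ℂ) (X : Matrix n n ℂ) :
    Matrix n n ℂ :=
  limUnder (𝓝[>] (0 : ℝ≥0)) fun t => (t : ℝ)⁻¹ • (T t X - X)

end QuantumSemigroup

open QuantumSemigroup

/-- A continuous quantum Markov semigroup on `B(ℂⁿ)`, in the Heisenberg picture. -/
structure QMS (n : Type*) [Fintype n] [DecidableEq n] where
  map : ℝ≥0 → Matrix n n ℂ →ₗ[ℂ] Matrix n n ℂ
  map_zero : map 0 = LinearMap.id
  map_add : ∀ s t, map (s + t) = map s ∘ₗ map t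
  completelyPositive : ∀ t, IsCompletelyPositive (map t)
  map_one : ∀ t, map t 1 = 1
  continuous : ∀ X, Continuous fun t => map t X

namespace QMS

variable {n : Type*} [Fintype n] [DecidableEq n]

/-- The Lindbladian `L`. -/
noncomputable def lindbladian (P : QMS n) : Matrix n n ℂ → Matrix n n ℂ :=
  generator P.map

/-- The generator `L_*` of the predual semigroup (Schrödinger picture). -/
noncomputable def lindbladianPredual (P : QMS n) : Matrix n n ℂ → Matrix n n ℂ :=
  generator fun t => predual (P.map t)

/-- `σ` is a faithful invariant state. -/
structure IsFaithfulInvariantState (P : QMS n) (σ : Matrix n n ℂ) : Prop where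
  isState : IsState σ
  posDef : σ.PosDef
  invariant : ∀ (t : ℝ≥0) (X : Matrix n n ℂ), (σ * P.map t X).trace = (σ * X).trace

/-- The decoherence-free algebra `N(P)`. -/
def dfAlgebra (P : QMS n) : Set (Matrix n n ℂ) :=
  {X | ∀ (t : ℝ≥0) (Y : Matrix n n ℂ),
    P.map t (Xᴴ * Y) = (P.map t X)ᴴ * P.map t Y ∧ P.map t (Y * Xᴴ) = P.map t Y * (P.map t X)ᴴ}

/-- `E` is the conditional expectation onto the decoherence-free algebra: a completely positive projection
with image `N(P)`, compatible with the faithful invariant states, whose kernel consists of the observables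
that vanish in the long time. The conditions on image and kernel alone determine `E`. -/
structure IsDFExpectation (P : QMS n) (E : Matrix n n ℂ →ₗ[ℂ] Matrix n n ℂ) : Prop where
  completelyPositive : IsCompletelyPositive E
  idempotent : ∀ X, E (E X) = E X
  range_eq : Set.range E = P.dfAlgebra
  compatible : ∀ σ, P.IsFaithfulInvariantState σ → ∀ X, (σ * E X).trace = (σ * X).trace
  ker_iff : ∀ X, E X = 0 ↔ Tendsto (fun t => P.map t X) atTop (𝓝 0)

theorem IsDFExpectation.unique {P : QMS n} {E F : Matrix n n ℂ →ₗ[ℂ] Matrix n n ℂ}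
    (hE : P.IsDFExpectation E) (hF : P.IsDFExpectation F) : E = F := by
  refine LinearMap.ext fun X => ?_
  have h1 : E (X - F X) = 0 := by
    rw [hE.ker_iff, ← hF.ker_iff, _root_.map_sub, hF.idempotent, sub_self]
  have h2 : F X ∈ Set.range E := by
    rw [hE.range_eq, ← hF.range_eq]
    exact ⟨X, rfl⟩
  obtain ⟨Z, hZ⟩ := h2
  have h3 : E (F X) = F X := by rw [← hZ, hE.idempotent]
  rw [_root_.map_sub, h3] at h1
  exact sub_eq_zero.mp h1

open Classical in
/-- The conditional expectation `E_N` onto the decoherence-free algebra (the default value `0` is not taken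
when `P` has a faithful invariant state). -/
noncomputable def dfExpectation (P : QMS n) : Matrix n n ℂ →ₗ[ℂ] Matrix n n ℂ :=
  if h : ∃ E, P.IsDFExpectation E then h.choose else 0

/-- The reference state `σ_Tr = E_{N*}(I / d)`. -/
noncomputable def sigmaTr (P : QMS n) : Matrix n n ℂ :=
  predual P.dfExpectation ((Fintype.card n : ℂ)⁻¹ • (1 : Matrix n n ℂ))

/-- The Dirichlet form `E_L(X) = -⟨X, L(X)⟩`, for the scalar product
`⟨X, Y⟩ = Tr[σ^{1/2} X^* σ^{1/2} Y]` with `σ = σ_Tr`. (The trace is real for every selfadjoint `X`.) -/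
noncomputable def dirichletForm (P : QMS n) (X : Matrix n n ℂ) : ℝ :=
  -(mpow P.sigmaTr (1 / 2) * Xᴴ * mpow P.sigmaTr (1 / 2) * P.lindbladian X).trace.re

open Classical in
/-- The entropy production `EP_L(ρ) = -Tr[L_*(ρ) (log ρ - log σ_Tr)]`, with values in `(-∞, +∞]`.
For a singular state `ρ`, `log ρ` is `-∞` on `ker ρ`, where the compression of `L_*(ρ)` is positive
semidefinite; with `0 · ∞ = 0` the value is therefore `+∞` unless this compression vanishes, and otherwise the
logarithm is taken on the support of `ρ`. For every state this is minus the right derivative at `t = 0` of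
the relative entropy of the evolved state with respect to `σ_Tr`. -/
noncomputable def entropyProduction (P : QMS n) (ρ : Matrix n n ℂ) : EReal :=
  if ∀ v : n → ℂ, ρ *ᵥ v = 0 → star v ⬝ᵥ (P.lindbladianPredual ρ *ᵥ v) = 0 then
    ((-(P.lindbladianPredual ρ * (mlog ρ - mlog P.sigmaTr)).trace.re : ℝ) : EReal)
  else ⊤

/-- The `σ_Tr`-detailed balance condition. -/
structure HasSigmaTrDBC (P : QMS n) : Prop where
  exists_faithful : ∃ σ, P.IsFaithfulInvariantState σ
  symm : ∀ (X Y : Matrix n n ℂ) (t : ℝ≥0),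
    (P.sigmaTr * Xᴴ * P.map t Y).trace = (P.sigmaTr * P.map t Xᴴ * Y).trace

/-- The matrix `σ_Tr^{-1/4} ρ^{1/2} σ_Tr^{-1/4}`. -/
noncomputable def relSqrt (P : QMS n) (ρ : Matrix n n ℂ) : Matrix n n ℂ :=
  mpow P.sigmaTr (-1 / 4) * mpow ρ (1 / 2) * mpow P.sigmaTr (-1 / 4)

/-- `𝕃₁`-regularity of the Dirichlet form. -/
def IsL1Regular (P : QMS n) : Prop :=
  ∀ ρ : Matrix n n ℂ, IsState ρ →
    ((2 * P.dirichletForm (P.relSqrt ρ) : ℝ) : EReal) ≤ P.entropyProduction ρ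

end QMS

/-!
Write `σ` for `sigmaTr`. The comparison of entropy production and Dirichlet form is first proved for
a single completely positive unital map `Φ` that is symmetric for `Tr[σ X^* Y]`, and then
differentiated along the semigroup.

For one map, let `Q_a` and `R_k` be the spectral projections of `σ` and `ρ`, with eigenvalues `s_a`
and `p_k`. Instead of a Kraus decomposition into eigenvectors of the modular group, the weights
`Tr[R_k Q_a Φ(Q_c R_l Q_d) Q_b]` are used. Detailed balance forces `s_a / s_c = s_b / s_d` on their
support (`weight_eq_zero`), so that they behave like positive jump rates `k → l` of modular
frequency `r = s_b / s_d` (`jump_nonneg`) which satisfy detailed balance (`jump_symm`). In these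
terms the entropy production of `ρ` is the integral of `p_k (log p_k - log p_l - log r)` and the
Dirichlet form of `σ^{-1/4} ρ^{1/2} σ^{-1/4}` that of `p_k - √(p_k p_l r)`. After symmetrization the
inequality reduces to `4 (√x - √y)² ≤ (x - y) (log x - log y)` with `x = p_k` and `y = r p_l`. For
singular `ρ` there remains an error of at most a constant times `Tr[ρ Φ(K)]`, where `K` projects
onto `ker ρ`; along the semigroup its derivative at `t = 0` is zero exactly when the entropy
production is finite (`four_mul_dirichletForm_le`).

The reference state is available because the conditional expectation exists: the semigroup is
bounded, hence has an idempotent limit point at infinity, and a fixed point of this limit is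
recurrent, so that each `P_t`, a contraction for `Tr[τ X^* X]` with `τ` any faithful invariant
state, is isometric there. By the Kadison–Schwarz inequality this places it in the multiplicative
domain (`isDFExpectation_of_limit`).

If the entropy production of `ρ` vanishes, so does the Dirichlet form at `W = ρ^{1/2} σ^{-1/2}`.
Then `W` is fixed by the semigroup, hence lies in the decoherence-free algebra, so `W^* W` is fixed
too, and `ρ = σ^{1/2} W^* W σ^{1/2}` is invariant. Conversely, under detailed balance the semigroup
is trivial on the decoherence-free algebra, so that a state fixed by the predual of the expectation
is invariant.
-/

namespace QuantumSemigroup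

variable {n : Type*} [Fintype n] [DecidableEq n]

/-! ### Completely positive maps -/

theorem comp_apply_apply {I J K L R : Type*} (M : Matrix I J (Matrix K L R)) (p : I × K)
    (q : J × L) : Matrix.comp I J K L R M p q = M p.1 q.1 p.2 q.2 :=
  rfl

theorem IsCompletelyPositive.posSemidef_comp {Φ : Matrix n n ℂ →ₗ[ℂ] Matrix n n ℂ}
    (hΦ : IsCompletelyPositive Φ) {k : ℕ} (X : Fin k → Matrix n n ℂ) :
    (Matrix.comp (Fin k) (Fin k) n n ℂ
      (Matrix.of fun i j => Φ ((X i)ᴴ * X j))).PosSemidef := by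
  refine hΦ k (Matrix.of fun i j => (X i)ᴴ * X j) ?_
  have h : Matrix.comp (Fin k) (Fin k) n n ℂ (Matrix.of fun i j => (X i)ᴴ * X j) =
      (Matrix.of fun (m : n) (p : Fin k × n) => X p.1 m p.2)ᴴ *
        Matrix.of fun (m : n) (p : Fin k × n) => X p.1 m p.2 := by
    ext ⟨i, a⟩ ⟨j, b⟩
    simp [Matrix.mul_apply]
  rw [h]
  exact Matrix.posSemidef_conjTranspose_mul_self _

theorem IsCompletelyPositive.map_conjTranspose {Φ : Matrix n n ℂ →ₗ[ℂ] Matrix n n ℂ}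
    (hΦ : IsCompletelyPositive Φ) (X : Matrix n n ℂ) : Φ Xᴴ = (Φ X)ᴴ := by
  have h := (hΦ.posSemidef_comp ![1, X]).isHermitian
  ext a b
  have := congrFun (congrFun h (1, a)) (0, b)
  simpa [comp_apply_apply] using this.symm

/-- Complete positivity tested on vectors: `∑ ⟨v_i, Φ(X_i^* X_j) v_j⟩ ≥ 0`. -/
theorem IsCompletelyPositive.sum_dotProduct_nonneg {Φ : Matrix n n ℂ →ₗ[ℂ] Matrix n n ℂ}
    (hΦ : IsCompletelyPositive Φ) {ι : Type*} [Fintype ι] (X : ι → Matrix n n ℂ)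
    (v : ι → n → ℂ) :
    0 ≤ ∑ i, ∑ j, star (v i) ⬝ᵥ (Φ ((X i)ᴴ * X j) *ᵥ v j) := by
  let e := Fintype.equivFin ι
  have h := (hΦ.posSemidef_comp (X ∘ e.symm)).dotProduct_mulVec_nonneg
    (fun p : Fin _ × n => v (e.symm p.1) p.2)
  have h2 : ∑ i, ∑ j, star (v i) ⬝ᵥ (Φ ((X i)ᴴ * X j) *ᵥ v j) =
      ∑ i, ∑ j, star (v (e.symm i)) ⬝ᵥ
        (Φ ((X (e.symm i))ᴴ * X (e.symm j)) *ᵥ v (e.symm j)) := by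
    rw [← e.symm.sum_comp]
    refine Finset.sum_congr rfl fun i _ => ?_
    rw [← e.symm.sum_comp]
  rw [h2]
  convert h using 1
  simp only [dotProduct, Matrix.mulVec, Fintype.sum_prod_type, comp_apply_apply, Finset.mul_sum,
    Matrix.of_apply, Function.comp, Pi.star_apply]
  refine Finset.sum_congr rfl fun i _ => ?_
  rw [Finset.sum_comm]

theorem trace_conjTranspose_mul_mul (Y A Z : Matrix n n ℂ) :
    (Yᴴ * A * Z).trace = ∑ c, star (fun a => Y a c) ⬝ᵥ (A *ᵥ fun b => Z b c) := by
  simp [Matrix.trace, Matrix.mul_assoc, Matrix.mul_apply, dotProduct, Matrix.mulVec]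

/-- Complete positivity tested on matrices, which collect the columns of several test vectors. -/
theorem IsCompletelyPositive.sum_trace_nonneg {Φ : Matrix n n ℂ →ₗ[ℂ] Matrix n n ℂ}
    (hΦ : IsCompletelyPositive Φ) {ι : Type*} [Fintype ι] (X Y : ι → Matrix n n ℂ) :
    0 ≤ ∑ i, ∑ j, ((Y i)ᴴ * Φ ((X i)ᴴ * X j) * Y j).trace := by
  have h : ∑ i, ∑ j, ((Y i)ᴴ * Φ ((X i)ᴴ * X j) * Y j).trace =
      ∑ c, ∑ i, ∑ j, star (fun a => Y i a c) ⬝ᵥ (Φ ((X i)ᴴ * X j) *ᵥ fun b => Y j b c) := by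
    simp only [trace_conjTranspose_mul_mul]
    rw [Finset.sum_comm]
    simp_rw [Finset.sum_comm (s := (Finset.univ : Finset ι)) (t := (Finset.univ : Finset n))]
    refine Finset.sum_congr rfl fun c _ => ?_
    rw [Finset.sum_comm]
  rw [h]
  exact Finset.sum_nonneg fun c _ => hΦ.sum_dotProduct_nonneg X fun i a => Y i a c

theorem IsCompletelyPositive.posSemidef_map {Φ : Matrix n n ℂ →ₗ[ℂ] Matrix n n ℂ}
    (hΦ : IsCompletelyPositive Φ) (X : Matrix n n ℂ) : (Φ (Xᴴ * X)).PosSemidef := by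
  refine Matrix.PosSemidef.of_dotProduct_mulVec_nonneg ?_ fun v => ?_
  · rw [Matrix.IsHermitian, ← hΦ.map_conjTranspose]
    simp
  · simpa using hΦ.sum_dotProduct_nonneg (fun _ : Unit => X) fun _ => v

/-- The Kadison–Schwarz inequality. -/
theorem IsCompletelyPositive.kadison_schwarz {Φ : Matrix n n ℂ →ₗ[ℂ] Matrix n n ℂ}
    (hΦ : IsCompletelyPositive Φ) (h1 : Φ 1 = 1) (X : Matrix n n ℂ) :
    (Φ (Xᴴ * X) - (Φ X)ᴴ * Φ X).PosSemidef := by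
  refine Matrix.PosSemidef.of_dotProduct_mulVec_nonneg ?_ fun v => ?_
  · rw [Matrix.IsHermitian, Matrix.conjTranspose_sub, ← hΦ.map_conjTranspose]
    simp
  · have h := hΦ.sum_dotProduct_nonneg ![X, 1] ![v, -(Φ X *ᵥ v)]
    simp only [Fin.sum_univ_two] at h
    simp only [Matrix.cons_val_zero, Matrix.cons_val_one, Matrix.conjTranspose_one, one_mul,
      mul_one, h1, hΦ.map_conjTranspose, Matrix.mulVec_neg, dotProduct_neg,
      star_neg, neg_dotProduct, neg_neg, Matrix.star_mulVec, ← Matrix.dotProduct_mulVec,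
      Matrix.mulVec_mulVec] at h
    rw [Matrix.sub_mulVec, dotProduct_sub]
    convert h using 1
    ring

/-- Equality in the Kadison–Schwarz inequality at `X` makes `Φ` multiplicative at `X`. -/
theorem IsCompletelyPositive.map_mul_of_eq {Φ : Matrix n n ℂ →ₗ[ℂ] Matrix n n ℂ}
    (hΦ : IsCompletelyPositive Φ) (h1 : Φ 1 = 1) {X : Matrix n n ℂ}
    (hX : Φ (Xᴴ * X) = (Φ X)ᴴ * Φ X) (Y : Matrix n n ℂ) :
    Φ (Xᴴ * Y) = (Φ X)ᴴ * Φ Y := by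
  set G := Φ (Xᴴ * Y) - (Φ X)ᴴ * Φ Y with hG
  suffices hG0 : G = 0 from sub_eq_zero.mp hG0
  have hGH : Φ (Yᴴ * X) = Gᴴ + (Φ Y)ᴴ * Φ X := by
    rw [hG, Matrix.conjTranspose_sub, ← hΦ.map_conjTranspose]
    simp
  have hGe : Φ (Xᴴ * Y) = G + (Φ X)ᴴ * Φ Y := by rw [hG]; abel
  -- Positivity on the triple `(X, Y, 1)` with the test vectors `-t G`, `1`, `t Φ(X) G - Φ(Y)`.
  have key : ∀ t : ℝ, 0 ≤ (Φ (Yᴴ * Y) - (Φ Y)ᴴ * Φ Y).trace.re - 2 * t * (Gᴴ * G).trace.re := by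
    intro t
    have h := hΦ.sum_trace_nonneg ![X, Y, 1] ![-(t : ℂ) • G, 1, (t : ℂ) • (Φ X * G) - Φ Y]
    have h' := (Complex.le_def.mp h).1
    simp only [Fin.sum_univ_three, Matrix.cons_val_zero, Matrix.cons_val_one, Matrix.cons_val,
      Matrix.conjTranspose_one, one_mul, mul_one, h1, hX, hGH, hGe, hΦ.map_conjTranspose,
      ← Matrix.trace_add, Complex.zero_re] at h'
    convert h' using 1
    have e : 2 * t * (Gᴴ * G).trace.re = ((2 * t : ℂ) • (Gᴴ * G)).trace.re := by
      simp [Matrix.trace_smul]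
    rw [e, ← Complex.sub_re, ← Matrix.trace_sub]
    congr 2
    simp only [Matrix.conjTranspose_smul, Matrix.conjTranspose_sub, Matrix.conjTranspose_mul,
      smul_mul_assoc, mul_smul_comm, mul_sub, sub_mul, mul_add, add_mul, neg_smul,
      Matrix.conjTranspose_neg, neg_mul, mul_neg, ← mul_assoc, smul_sub, smul_add,
      smul_smul, Complex.star_def, Complex.conj_ofReal, smul_neg]
    module
  have h0 : (Gᴴ * G).trace = 0 := by
    have hre : (Gᴴ * G).trace.re ≤ 0 := by
      by_contra hc
      push Not at hc
      have := key (((Φ (Yᴴ * Y) - (Φ Y)ᴴ * Φ Y).trace.re + 1) / (Gᴴ * G).trace.re)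
      field_simp at this
      have h2 := key 0
      simp at h2 this
      linarith
    have hn := (Matrix.posSemidef_conjTranspose_mul_self G).trace_nonneg
    exact le_antisymm (Complex.le_def.mpr ⟨hre, (Complex.le_def.mp hn).2.symm⟩) hn
  exact Matrix.trace_conjTranspose_mul_self_eq_zero_iff.mp h0

/-! ### Positive matrices and spectral resolutions -/

theorem PosDef.trace_mul_conjTranspose_mul_nonneg {σ : Matrix n n ℂ} (hσ : σ.PosDef)
    (X : Matrix n n ℂ) : 0 ≤ (σ * (Xᴴ * X)).trace := by
  have h := (hσ.posSemidef.mul_mul_conjTranspose_same X).trace_nonneg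
  rwa [Matrix.trace_mul_cycle, ← Matrix.trace_mul_comm] at h

theorem PosDef.trace_mul_conjTranspose_mul_eq_zero {σ : Matrix n n ℂ} (hσ : σ.PosDef)
    {X : Matrix n n ℂ} (h : (σ * (Xᴴ * X)).trace = 0) : X = 0 := by
  rw [Matrix.trace_mul_comm, Matrix.mul_assoc, Matrix.trace_mul_comm] at h
  have h2 := (hσ.posSemidef.mul_mul_conjTranspose_same X).trace_eq_zero_iff.mp h
  ext i j
  have h3 := congrFun (congrFun h2 i) i
  by_contra hne
  have h4 := hσ.dotProduct_mulVec_pos (x := fun j => star (X i j))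
    (fun h0 => hne (by simpa using congrFun h0 j))
  refine h4.ne' ?_
  rw [Matrix.mul_assoc] at h3
  simpa [Matrix.mul_apply, dotProduct, Matrix.mulVec] using h3

theorem PosSemidef.exists_conjTranspose_mul_self {A : Matrix n n ℂ} (hA : A.PosSemidef) :
    ∃ B : Matrix n n ℂ, A = Bᴴ * B := by
  open scoped MatrixOrder in
  obtain ⟨B, hB⟩ := CStarAlgebra.nonneg_iff_eq_star_mul_self.mp hA.nonneg
  exact ⟨B, hB⟩

/-- A resolution of the identity into orthogonal projections. -/
structure IsResolution {ι : Type*} [Fintype ι] [DecidableEq ι] (Q : ι → Matrix n n ℂ) : Prop where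
  conjTranspose_eq : ∀ a, (Q a)ᴴ = Q a
  mul_eq : ∀ a b, Q a * Q b = if a = b then Q a else 0
  sum_eq_one : ∑ a, Q a = 1

/-- The spectral theorem, in the form in which one resolution computes every `cfc f A`. -/
theorem exists_isResolution {A : Matrix n n ℂ} (hA : A.IsHermitian) :
    ∃ Q : n → Matrix n n ℂ, IsResolution Q ∧
      ∀ f : ℝ → ℝ, cfc f A = ∑ a, (f (hA.eigenvalues a) : ℂ) • Q a := by
  set U : Matrix n n ℂ := ↑hA.eigenvectorUnitary with hU
  have hU1 : Uᴴ * U = 1 := Unitary.coe_star_mul_self hA.eigenvectorUnitary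
  have hU2 : U * Uᴴ = 1 := Unitary.coe_mul_star_self hA.eigenvectorUnitary
  refine ⟨fun a => U * Matrix.single a a 1 * Uᴴ, ⟨fun a => ?_, fun a b => ?_, ?_⟩, fun f => ?_⟩
  · simp [Matrix.mul_assoc]
  · have e : U * Matrix.single a a 1 * Uᴴ * (U * Matrix.single b b 1 * Uᴴ) =
        U * (Matrix.single a a 1 * (Uᴴ * U) * Matrix.single b b 1) * Uᴴ := by
      simp only [Matrix.mul_assoc]
    rw [e, hU1, mul_one]
    by_cases hab : a = b
    · subst hab
      simp
    · simp [hab]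
  · rw [← Finset.sum_mul, ← Finset.mul_sum, Matrix.sum_single_one, mul_one, hU2]
  · rw [hA.cfc_eq, Matrix.IsHermitian.cfc, Unitary.conjStarAlgAut_apply]
    have hd : Matrix.diagonal ((RCLike.ofReal : ℝ → ℂ) ∘ f ∘ hA.eigenvalues) =
        ∑ a, (f (hA.eigenvalues a) : ℂ) • Matrix.single a a (1 : ℂ) := by
      rw [← Matrix.sum_single_eq_diagonal]
      simp
    rw [hd, ← hU, Finset.mul_sum, Finset.sum_mul]
    simp only [mul_smul_comm, smul_mul_assoc, Matrix.star_eq_conjTranspose]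

theorem exists_smul_one_sub_posSemidef {A : Matrix n n ℂ} (hA : A.IsHermitian) :
    ∃ c : ℝ, ((c : ℂ) • (1 : Matrix n n ℂ) - A).PosSemidef := by
  obtain ⟨Q, hQ, hf⟩ := exists_isResolution hA
  refine ⟨∑ a, |hA.eigenvalues a|, ?_⟩
  have h1 := hf id
  rw [cfc_id ℝ A hA.isSelfAdjoint] at h1
  have h2 := congrArg
    (fun B => ((∑ a, |hA.eigenvalues a| : ℝ) : ℂ) • (1 : Matrix n n ℂ) - B) h1
  beta_reduce at h2
  rw [h2, ← hQ.sum_eq_one, Finset.smul_sum, ← Finset.sum_sub_distrib]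
  refine Matrix.posSemidef_sum _ fun a _ => ?_
  rw [← sub_smul]
  have hP : (Q a).PosSemidef := by
    have := Matrix.posSemidef_conjTranspose_mul_self (Q a)
    rwa [hQ.conjTranspose_eq, hQ.mul_eq, if_pos rfl] at this
  refine hP.smul ?_
  rw [← Complex.ofReal_sub, Complex.zero_le_real, sub_nonneg]
  exact (le_abs_self _).trans
    (Finset.single_le_sum (f := fun a => |hA.eigenvalues a|) (fun _ _ => abs_nonneg _)
      (Finset.mem_univ a))

/-! ### Entropy production of a single map -/

/-- The logarithmic mean inequality, which in the commutative case is the whole comparison. -/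
theorem four_mul_sq_sqrt_sub_sqrt_le {x y : ℝ} (hx : 0 < x) (hy : 0 < y) :
    4 * (√x - √y) ^ 2 ≤ (x - y) * (Real.log x - Real.log y) := by
  wlog hxy : y ≤ x generalizing x y
  · have := this hy hx (le_of_not_ge hxy)
    nlinarith
  obtain ⟨u, hu, rfl⟩ : ∃ u, 0 < u ∧ x = u ^ 2 := ⟨√x, Real.sqrt_pos.mpr hx, by simp [hx.le]⟩
  obtain ⟨v, hv, rfl⟩ : ∃ v, 0 < v ∧ y = v ^ 2 := ⟨√y, Real.sqrt_pos.mpr hy, by simp [hy.le]⟩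
  have huv : v ≤ u := by nlinarith
  rw [Real.sqrt_sq hu.le, Real.sqrt_sq hv.le, Real.log_pow, Real.log_pow]
  have h := Real.le_log_one_add_of_nonneg (x := u / v - 1) (by
    rw [sub_nonneg, one_le_div hv]; exact huv)
  rw [add_sub_cancel, Real.log_div hu.ne' hv.ne'] at h
  have e : 2 * (u / v - 1) / (u / v - 1 + 2) = 2 * (u - v) / (u + v) := by
    have : u + v ≠ 0 := by positivity
    have e1 : u / v - 1 + 2 = (u + v) / v := by field_simp; ring
    rw [e1]
    field_simp
  rw [e, div_le_iff₀ (by positivity)] at h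
  push_cast
  nlinarith [mul_le_mul_of_nonneg_left h (sub_nonneg.mpr huv)]

/-- Symmetry of a hermiticity-preserving map `Φ` for the scalar product `Tr[σ X^* Y]`, written
bilinearly with `X` in place of `X^*`. -/
def IsGNSSymmetric (σ : Matrix n n ℂ) (Φ : Matrix n n ℂ →ₗ[ℂ] Matrix n n ℂ) : Prop :=
  ∀ X Y, (σ * X * Φ Y).trace = (σ * Φ X * Y).trace

section Resolution

variable {ι κ : Type*} [Fintype ι] [DecidableEq ι] [Fintype κ] [DecidableEq κ]

theorem IsResolution.sum_smul_mul {Q : ι → Matrix n n ℂ} (hQ : IsResolution Q) (x : ι → ℂ) (b : ι) :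
    (∑ a, x a • Q a) * Q b = x b • Q b := by
  simp [Finset.sum_mul, hQ.mul_eq]

theorem IsResolution.mul_sum_smul {Q : ι → Matrix n n ℂ} (hQ : IsResolution Q) (x : ι → ℂ) (b : ι) :
    Q b * (∑ a, x a • Q a) = x b • Q b := by
  simp [Finset.mul_sum, hQ.mul_eq]

theorem IsResolution.sum_smul_mul_sum_smul {Q : ι → Matrix n n ℂ} (hQ : IsResolution Q)
    (x y : ι → ℂ) : (∑ a, x a • Q a) * (∑ a, y a • Q a) = ∑ a, (x a * y a) • Q a := by
  simp [Finset.mul_sum, Finset.sum_mul, hQ.mul_eq, smul_smul, mul_comm]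

/-- The weight `Tr[R_k Q_a Φ(Q_c R_l Q_d) Q_b]`, with `τ = (a, b, c, d)`. For a Kraus decomposition
`Φ(X) = ∑ V_j^* X V_j` and rank-one `R_k = |k⟩⟨k|` these refine the jump rates `∑ |⟨l|V_j|k⟩|²`. -/
noncomputable def weight (Q : ι → Matrix n n ℂ) (R : κ → Matrix n n ℂ)
    (Φ : Matrix n n ℂ →ₗ[ℂ] Matrix n n ℂ) (k l : κ) (τ : ι × ι × ι × ι) : ℂ :=
  (R k * Q τ.1 * Φ (Q τ.2.2.1 * R l * Q τ.2.2.2) * Q τ.2.1).trace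

variable {Q : ι → Matrix n n ℂ} {R : κ → Matrix n n ℂ} {Φ : Matrix n n ℂ →ₗ[ℂ] Matrix n n ℂ}
  {s : ι → ℝ}

/-- Detailed balance of the weights. -/
theorem weight_symm (hQ : IsResolution Q) (hs : IsGNSSymmetric (∑ a, (s a : ℂ) • Q a) Φ)
    (k l : κ) (a b c d : ι) :
    (s b : ℂ) * weight Q R Φ k l (a, b, c, d) = s d * weight Q R Φ l k (d, c, b, a) := by
  set σ := ∑ a, (s a : ℂ) • Q a with hσ
  have h := hs (Q b * R k * Q a) (Q c * R l * Q d)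
  have h1 : (σ * (Q b * R k * Q a) * Φ (Q c * R l * Q d)).trace =
      (s b : ℂ) * weight Q R Φ k l (a, b, c, d) := by
    rw [← Matrix.mul_assoc, ← Matrix.mul_assoc, hσ, hQ.sum_smul_mul, weight]
    simp only [smul_mul_assoc, Matrix.trace_smul, smul_eq_mul]
    rw [Matrix.trace_mul_comm _ (Q b)]
    simp only [Matrix.mul_assoc]
  have h2 : (σ * Φ (Q b * R k * Q a) * (Q c * R l * Q d)).trace =
      (s d : ℂ) * weight Q R Φ l k (d, c, b, a) := by
    rw [Matrix.trace_mul_comm, ← Matrix.mul_assoc, Matrix.mul_assoc _ (Q d) σ, hσ,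
      hQ.mul_sum_smul, weight]
    simp only [smul_mul_assoc, mul_smul_comm, Matrix.trace_smul, smul_eq_mul]
    rw [Matrix.trace_mul_comm _ (Q c)]
    simp only [Matrix.mul_assoc]
  rw [← h1, ← h2, h]

/-- Applying the symmetry twice shows that the weights vanish unless `s_a / s_c = s_b / s_d`; this
is the commutation of `Φ` with the modular group of `σ`. -/
theorem weight_eq_zero (hQ : IsResolution Q) (hs : IsGNSSymmetric (∑ a, (s a : ℂ) • Q a) Φ)
    (hpos : ∀ a, 0 < s a) (k l : κ) {a b c d : ι} (h : s a / s c ≠ s b / s d) :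
    weight Q R Φ k l (a, b, c, d) = 0 := by
  have h1 := weight_symm (R := R) hQ hs k l a b c d
  have h2 := weight_symm (R := R) hQ hs l k d c b a
  by_contra hw
  apply h
  rw [div_eq_div_iff (hpos c).ne' (hpos d).ne']
  have h3 : ((s b * s c : ℝ) : ℂ) * weight Q R Φ k l (a, b, c, d) =
      ((s a * s d : ℝ) : ℂ) * weight Q R Φ k l (a, b, c, d) := by
    push_cast
    linear_combination (s c : ℂ) * h1 + (s d : ℂ) * h2
  exact_mod_cast (mul_right_cancel₀ hw h3).symm

/-- The integral of `g` against the jump rates from `k` to `l`, resolved according to the modular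
frequency. The frequency is read off from `s_b / s_d`, which equals `s_a / s_c` wherever the weight
is nonzero. Only the real part of the weight is kept. -/
noncomputable def jump (s : ι → ℝ) (Q : ι → Matrix n n ℂ) (R : κ → Matrix n n ℂ)
    (Φ : Matrix n n ℂ →ₗ[ℂ] Matrix n n ℂ) (k l : κ) (g : ℝ → ℝ) : ℝ :=
  ∑ τ : ι × ι × ι × ι, (weight Q R Φ k l τ).re * g (s τ.2.1 / s τ.2.2.2)

/-- Integrals of nonnegative functions against the jump rates are nonnegative, although individual
weights need not be: since the weights conserve `s_b / s_d`, the factor `g` can be split into square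
roots at the two ends of the completely positive form. -/
theorem jump_nonneg (hQ : IsResolution Q) (hR : IsResolution R)
    (hs : IsGNSSymmetric (∑ a, (s a : ℂ) • Q a) Φ) (hΦ : IsCompletelyPositive Φ)
    (hpos : ∀ a, 0 < s a) (k l : κ) {g : ℝ → ℝ} (hg : ∀ b d, 0 ≤ g (s b / s d)) :
    0 ≤ jump s Q R Φ k l g := by
  have h := hΦ.sum_trace_nonneg (ι := ι × ι) (fun p => R l * Q p.2)
    (fun p => (√(g (s p.1 / s p.2)) : ℂ) • (Q p.1 * R k))
  have h' := (Complex.le_def.mp h).1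
  refine h'.trans_eq ?_
  have key : ∀ a c b d : ι,
      (((√(g (s a / s c)) : ℂ) • (Q a * R k))ᴴ * Φ ((R l * Q c)ᴴ * (R l * Q d)) *
        ((√(g (s b / s d)) : ℂ) • (Q b * R k))).trace =
      weight Q R Φ k l (a, b, c, d) * (g (s b / s d) : ℝ) := by
    intro a c b d
    have e1 : (R l * Q c)ᴴ * (R l * Q d) = Q c * R l * Q d := by
      rw [Matrix.conjTranspose_mul, hQ.conjTranspose_eq, hR.conjTranspose_eq, Matrix.mul_assoc,
        ← Matrix.mul_assoc (R l), hR.mul_eq, if_pos rfl, Matrix.mul_assoc]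
    have e2 : (((√(g (s a / s c)) : ℂ) • (Q a * R k))ᴴ * Φ (Q c * R l * Q d) *
        ((√(g (s b / s d)) : ℂ) • (Q b * R k))).trace =
        (√(g (s a / s c)) : ℂ) * √(g (s b / s d)) * weight Q R Φ k l (a, b, c, d) := by
      rw [Matrix.conjTranspose_smul, Matrix.conjTranspose_mul, hQ.conjTranspose_eq,
        hR.conjTranspose_eq, Complex.star_def, Complex.conj_ofReal]
      simp only [smul_mul_assoc, mul_smul_comm, Matrix.trace_smul, smul_eq_mul]
      have e3 : (R k * Q a * Φ (Q c * R l * Q d) * (Q b * R k)).trace =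
          weight Q R Φ k l (a, b, c, d) := by
        rw [← Matrix.mul_assoc, Matrix.trace_mul_comm, weight]
        simp only [← Matrix.mul_assoc]
        rw [hR.mul_eq, if_pos rfl]
      rw [e3]
      ring
    rw [e1, e2]
    by_cases hab : s a / s c = s b / s d
    · rw [hab, ← Complex.ofReal_mul, Real.mul_self_sqrt (hg b d), mul_comm]
    · rw [weight_eq_zero hQ hs hpos k l hab]
      simp
  simp only [key, jump]
  rw [Complex.re_sum]
  simp only [Complex.re_sum, Complex.re_mul_ofReal, Fintype.sum_prod_type]
  refine Finset.sum_congr rfl fun a _ => ?_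
  rw [Finset.sum_comm]

/-- The reversed jump has inverse modular frequency, and its rate is multiplied by `r`. -/
theorem jump_symm (hQ : IsResolution Q) (hs : IsGNSSymmetric (∑ a, (s a : ℂ) • Q a) Φ)
    (hpos : ∀ a, 0 < s a) (k l : κ) (g : ℝ → ℝ) :
    jump s Q R Φ k l g = jump s Q R Φ l k fun r => r * g r⁻¹ := by
  let e : ι × ι × ι × ι ≃ ι × ι × ι × ι :=
    { toFun := fun τ => (τ.2.2.2, τ.2.2.1, τ.2.1, τ.1)
      invFun := fun τ => (τ.2.2.2, τ.2.2.1, τ.2.1, τ.1)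
      left_inv := fun _ => rfl
      right_inv := fun _ => rfl }
  refine Fintype.sum_equiv e _ _ ?_
  rintro ⟨a, b, c, d⟩
  change (weight Q R Φ k l (a, b, c, d)).re * g (s b / s d) =
    (weight Q R Φ l k (d, c, b, a)).re * (s c / s a * g (s c / s a)⁻¹)
  by_cases hab : s a / s c = s b / s d
  · have h1 := congrArg Complex.re (weight_symm (R := R) hQ hs k l a b c d)
    rw [Complex.re_ofReal_mul, Complex.re_ofReal_mul] at h1
    have h2 : s c / s a = (s b / s d)⁻¹ := by rw [← hab, inv_div]
    rw [h2, inv_inv]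
    have hb := (hpos b).ne'
    have hd := (hpos d).ne'
    field_simp
    linear_combination g (s b / s d) * h1
  · have hab' : s d / s b ≠ s c / s a := fun h => hab (by rw [← inv_div, ← h, inv_div])
    rw [weight_eq_zero hQ hs hpos k l hab, weight_eq_zero hQ hs hpos l k hab']
    simp

/-- Sums of weights with product coefficients are traces of functions of `ρ` and `σ`. -/
theorem sum_weight (x y : κ → ℂ) (β δ : ι → ℂ) (hQ : IsResolution Q) :
    ∑ k, ∑ l, ∑ τ : ι × ι × ι × ι, x k * y l * (weight Q R Φ k l τ * (β τ.2.1 * δ τ.2.2.2)) =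
      ((∑ k, x k • R k) * Φ ((∑ l, y l • R l) * ∑ d, δ d • Q d) * ∑ b, β b • Q b).trace := by
  have h : ((∑ k, x k • R k) * Φ ((∑ l, y l • R l) * ∑ d, δ d • Q d) * ∑ b, β b • Q b) =
      (∑ k, x k • R k) * (∑ a, Q a) * Φ ((∑ c, Q c) * (∑ l, y l • R l) * ∑ d, δ d • Q d) *
        ∑ b, β b • Q b := by
    simp [hQ.sum_eq_one]
  rw [h]
  simp only [Fintype.sum_prod_type, weight, Finset.sum_mul, Finset.mul_sum, map_sum,
    Matrix.trace_sum, smul_mul_assoc, mul_smul_comm, map_smul, Matrix.trace_smul, smul_eq_mul]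
  simp only [← Fintype.sum_prod_type']
  let e : κ × κ × ι × ι × ι × ι ≃ ι × ι × κ × ι × ι × κ :=
    { toFun := fun p => (p.2.2.2.1, p.2.2.2.2.2, p.2.1, p.2.2.2.2.1, p.2.2.1, p.1)
      invFun := fun p => (p.2.2.2.2.2, p.2.2.1, p.2.2.2.2.1, p.1, p.2.2.2.1, p.2.1)
      left_inv := fun _ => rfl
      right_inv := fun _ => rfl }
  refine Fintype.sum_equiv e _ _ fun p => ?_
  simp only [e, Equiv.coe_fn_mk]
  ring

theorem sum_jump (x y : κ → ℝ) (β δ : ι → ℝ) (hQ : IsResolution Q) (g : ℝ → ℝ)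
    (hg : ∀ b d, g (s b / s d) = β b * δ d) :
    ∑ k, ∑ l, x k * y l * jump s Q R Φ k l g =
      ((∑ k, (x k : ℂ) • R k) * Φ ((∑ l, (y l : ℂ) • R l) * ∑ d, (δ d : ℂ) • Q d) *
        ∑ b, (β b : ℂ) • Q b).trace.re := by
  rw [← sum_weight _ _ _ _ hQ]
  simp only [Complex.re_sum, jump, Finset.mul_sum, hg, ← Complex.ofReal_mul, Complex.re_ofReal_mul,
    Complex.re_mul_ofReal]

theorem sum_jump_of_add (x y : κ → ℝ) (β δ : ι → ℝ) (hQ : IsResolution Q) (g : ℝ → ℝ)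
    (hg : ∀ b d, g (s b / s d) = β b + δ d) :
    ∑ k, ∑ l, x k * y l * jump s Q R Φ k l g =
      ((∑ k, (x k : ℂ) • R k) * Φ (∑ l, (y l : ℂ) • R l) *
        ∑ b, (β b : ℂ) • Q b).trace.re +
      ((∑ k, (x k : ℂ) • R k) * Φ ((∑ l, (y l : ℂ) • R l) * ∑ d, (δ d : ℂ) • Q d)).trace.re := by
  have h1 := sum_weight (Φ := Φ) (R := R) (fun k => (x k : ℂ)) (fun k => (y k : ℂ))
    (fun b => (β b : ℂ)) (fun _ => 1) hQ
  have h2 := sum_weight (Φ := Φ) (R := R) (fun k => (x k : ℂ)) (fun k => (y k : ℂ))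
    (fun _ => 1) (fun d => (δ d : ℂ)) hQ
  simp only [one_smul, hQ.sum_eq_one, mul_one, one_mul] at h1 h2
  rw [← h1, ← h2]
  simp only [Complex.re_sum, jump, Finset.mul_sum, hg, ← Complex.ofReal_mul, Complex.re_ofReal_mul,
    Complex.re_mul_ofReal, ← Finset.sum_add_distrib, mul_add]

theorem jump_add (s : ι → ℝ) (k l : κ) (f g : ℝ → ℝ) :
    jump s Q R Φ k l (fun r => f r + g r) = jump s Q R Φ k l f + jump s Q R Φ k l g := by
  simp [jump, mul_add, Finset.sum_add_distrib]

/-- The integrand of entropy production minus four times the Dirichlet form, added to its reversal,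
is nonnegative. If `p` and `q` are positive this is `four_mul_sq_sqrt_sub_sqrt_le` at `p` and `r q`.
If one of them vanishes, `Real.log 0 = 0` in place of `-∞` spoils the inequality, and the term with
`C` compensates for it. -/
theorem symmetrized_integrand_nonneg {C p q r : ℝ} (hp : 0 ≤ p) (hq : 0 ≤ q) (hr : 0 < r)
    (hC : ∀ r', (r' = r ∨ r' = r⁻¹) → ∀ p', (p' = p ∨ p' = q) →
      0 ≤ Real.log p' - Real.log r' - 4 + C) :
    0 ≤ (p * (Real.log p - Real.log q - Real.log r) - 4 * p + 4 * (√p * √q * √r) +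
        C * (p * if q = 0 then 1 else 0)) +
      r * (q * (Real.log q - Real.log p - Real.log r⁻¹) - 4 * q + 4 * (√q * √p * √r⁻¹) +
        C * (q * if p = 0 then 1 else 0)) := by
  have h1 := hC r (Or.inl rfl) p (Or.inl rfl)
  have h2 := hC r⁻¹ (Or.inr rfl) q (Or.inr rfl)
  rcases hp.eq_or_lt with rfl | hp'
  · rcases hq.eq_or_lt with rfl | hq'
    · simp
    · have := mul_nonneg (mul_nonneg hr.le hq) h2
      rw [Real.log_inv] at this
      simp
      linarith
  · rcases hq.eq_or_lt with rfl | hq'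
    · have := mul_nonneg hp h1
      simp
      nlinarith
    · have h := four_mul_sq_sqrt_sub_sqrt_le hp' (mul_pos hr hq')
      have e : r * √r⁻¹ = √r := by
        rw [Real.sqrt_inv, ← div_eq_mul_inv, Real.div_sqrt]
      rw [Real.log_mul hr.ne' hq'.ne', Real.sqrt_mul hr.le] at h
      rw [if_neg hp'.ne', if_neg hq'.ne', Real.log_inv]
      have h3 : (√p - √r * √q) ^ 2 = p + r * q - 2 * (√p * √q * √r) := by
        have e1 := Real.sq_sqrt hp
        have e2 := Real.sq_sqrt hq
        have e3 := Real.sq_sqrt hr.le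
        calc (√p - √r * √q) ^ 2 = √p ^ 2 + √r ^ 2 * √q ^ 2 - 2 * (√p * √q * √r) := by ring
          _ = _ := by rw [e1, e2, e3]
      rw [h3] at h
      linear_combination h - 4 * √q * √p * e

theorem jump_comparison (hQ : IsResolution Q) (hR : IsResolution R) {p : κ → ℝ}
    (hs : IsGNSSymmetric (∑ a, (s a : ℂ) • Q a) Φ) (hΦ : IsCompletelyPositive Φ)
    (hpos : ∀ a, 0 < s a) (hp : ∀ k, 0 ≤ p k) {C : ℝ}
    (hC : ∀ k b d, 0 ≤ Real.log (p k) - Real.log (s b / s d) - 4 + C) :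
    0 ≤ ∑ k, ∑ l, jump s Q R Φ k l (fun r =>
      p k * (Real.log (p k) - Real.log (p l) - Real.log r) - 4 * p k + 4 * (√(p k) * √(p l) * √r) +
        C * (p k * if p l = 0 then 1 else 0)) := by
  set h : κ → κ → ℝ → ℝ := fun k l r =>
    p k * (Real.log (p k) - Real.log (p l) - Real.log r) - 4 * p k + 4 * (√(p k) * √(p l) * √r) +
      C * (p k * if p l = 0 then 1 else 0) with hh
  change 0 ≤ ∑ k, ∑ l, jump s Q R Φ k l (h k l)
  have h2 : 0 ≤ ∑ k, ∑ l, (jump s Q R Φ k l (h k l) + jump s Q R Φ l k (h l k)) := by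
    refine Finset.sum_nonneg fun k _ => Finset.sum_nonneg fun l _ => ?_
    rw [jump_symm hQ hs hpos l k, ← jump_add]
    refine jump_nonneg hQ hR hs hΦ hpos k l fun b d => ?_
    refine symmetrized_integrand_nonneg (hp k) (hp l) (div_pos (hpos b) (hpos d)) ?_
    rintro r' hr' p' (rfl | rfl) <;> rcases hr' with rfl | rfl <;>
      first | exact hC _ _ _ | (rw [inv_div]; exact hC _ _ _)
  simp only [Finset.sum_add_distrib] at h2
  rw [Finset.sum_comm (f := fun k l => jump s Q R Φ l k (h l k))] at h2
  linarith

/-- The comparison of entropy production and Dirichlet form for one map, in terms of spectral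
resolutions. The last term is the mass moved into the kernel of `ρ`. -/
theorem entropy_sub_dirichlet_le (hQ : IsResolution Q) (hR : IsResolution R) {p : κ → ℝ}
    (hs : IsGNSSymmetric (∑ a, (s a : ℂ) • Q a) Φ) (hΦ : IsCompletelyPositive Φ) (h1 : Φ 1 = 1)
    (hpos : ∀ a, 0 < s a) (hp : ∀ k, 0 ≤ p k) {C : ℝ}
    (hC : ∀ k b d, 0 ≤ Real.log (p k) - Real.log (s b / s d) - 4 + C) :
    0 ≤ ((∑ k, (p k : ℂ) • R k) * ((∑ k, (Real.log (p k) : ℂ) • R k) -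
          ∑ a, (Real.log (s a) : ℂ) • Q a)).trace.re
      - ((∑ k, (p k : ℂ) • R k) * Φ ((∑ k, (Real.log (p k) : ℂ) • R k) -
          ∑ a, (Real.log (s a) : ℂ) • Q a)).trace.re
      - 4 * (∑ k, (p k : ℂ) • R k).trace.re
      + 4 * ((∑ k, (√(p k) : ℂ) • R k) * Φ ((∑ k, (√(p k) : ℂ) • R k) *
          ∑ a, ((√(s a))⁻¹ : ℂ) • Q a) * ∑ a, (√(s a) : ℂ) • Q a).trace.re
      + C * ((∑ k, (p k : ℂ) • R k) *
          Φ (∑ k, ((if p k = 0 then 1 else 0 : ℝ) : ℂ) • R k)).trace.re := by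
  refine (jump_comparison hQ hR hs hΦ hpos hp hC).trans_eq ?_
  have hsplit : ∀ k l, jump s Q R Φ k l (fun r =>
      p k * (Real.log (p k) - Real.log (p l) - Real.log r) - 4 * p k + 4 * (√(p k) * √(p l) * √r) +
        C * (p k * if p l = 0 then 1 else 0)) =
      (p k * Real.log (p k)) * 1 * jump s Q R Φ k l (fun _ => 1)
      - p k * Real.log (p l) * jump s Q R Φ k l (fun _ => 1)
      - p k * 1 * jump s Q R Φ k l Real.log
      - 4 * (p k * 1 * jump s Q R Φ k l (fun _ => 1))
      + 4 * (√(p k) * √(p l) * jump s Q R Φ k l Real.sqrt)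
      + C * (p k * (if p l = 0 then 1 else 0) * jump s Q R Φ k l (fun _ => 1)) := by
    intro k l
    simp only [jump, Finset.mul_sum, ← Finset.sum_add_distrib, ← Finset.sum_sub_distrib]
    refine Finset.sum_congr rfl fun τ _ => ?_
    ring
  have hdist : ∀ a₁ a₂ a₃ a₄ a₅ a₆ : κ → κ → ℝ,
      ∑ k, ∑ l, (a₁ k l - a₂ k l - a₃ k l - 4 * a₄ k l + 4 * a₅ k l + C * a₆ k l) =
      (∑ k, ∑ l, a₁ k l) - (∑ k, ∑ l, a₂ k l) - (∑ k, ∑ l, a₃ k l) - 4 * (∑ k, ∑ l, a₄ k l) +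
        4 * (∑ k, ∑ l, a₅ k l) + C * ∑ k, ∑ l, a₆ k l := by
    intros
    simp only [Finset.sum_add_distrib, Finset.sum_sub_distrib, Finset.mul_sum]
  have hc : ∀ b d, (fun _ : ℝ => (1 : ℝ)) (s b / s d) = (fun _ : ι => (1 : ℝ)) b *
      (fun _ : ι => (1 : ℝ)) d := by simp
  have hr : ∀ b d, √(s b / s d) = √(s b) * (√(s d))⁻¹ := fun b d => by
    rw [Real.sqrt_div (hpos b).le, div_eq_mul_inv]
  have hl : ∀ b d, Real.log (s b / s d) = Real.log (s b) + -Real.log (s d) := fun b d => by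
    rw [Real.log_div (hpos b).ne' (hpos d).ne', sub_eq_add_neg]
  simp only [hsplit]
  rw [hdist, sum_jump (fun k => p k * Real.log (p k)) (fun _ => 1) _ _ hQ (fun _ => 1) hc,
    sum_jump p (fun k => Real.log (p k)) _ _ hQ (fun _ => 1) hc,
    sum_jump p (fun _ => 1) _ _ hQ (fun _ => 1) hc,
    sum_jump (fun k => √(p k)) (fun k => √(p k)) _ _ hQ _ hr,
    sum_jump p (fun k => if p k = 0 then 1 else 0) _ _ hQ (fun _ => 1) hc,
    sum_jump_of_add p (fun _ => 1) _ _ hQ _ hl]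
  simp only [Complex.ofReal_one, one_smul, hQ.sum_eq_one, hR.sum_eq_one, mul_one, one_mul, h1,
    Complex.ofReal_mul, Complex.ofReal_neg, neg_smul, Finset.sum_neg_distrib, map_neg, mul_neg,
    Matrix.trace_neg, Complex.neg_re, Complex.ofReal_inv, map_sub, mul_sub, Matrix.trace_sub,
    Complex.sub_re, hR.sum_smul_mul_sum_smul]
  ring

end Resolution

/-! ### One-parameter semigroups in finite dimension -/

section Semigroup

/-- A norm-continuous one-parameter semigroup in a Banach algebra has a generator: for small `h` the
integral `F(h)` over `[0, h]` is invertible, and `T(t) F(h) = F(t + h) - F(t)` is differentiable. -/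
theorem exists_tendsto_generator {A : Type*} [NormedRing A] [NormedAlgebra ℂ A] [CompleteSpace A]
    {T : ℝ≥0 → A} (hT : Continuous T) (h0 : T 0 = 1) (hadd : ∀ s t, T (s + t) = T s * T t) :
    ∃ L : A, Tendsto (fun t : ℝ≥0 => (t : ℝ)⁻¹ • (T t - 1)) (𝓝[>] 0) (𝓝 L) := by
  set M : ℝ → A := fun t => T t.toNNReal with hM
  have hMc : Continuous M := hT.comp continuous_real_toNNReal
  set F : ℝ → A := fun u => ∫ x in (0 : ℝ)..u, M x with hF
  have hF' : ∀ u, HasDerivAt F (M u) u := fun u =>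
    (hMc.integral_hasStrictDerivAt 0 u).hasDerivAt
  have hM0 : M 0 = 1 := by simp [hM, h0]
  have hF0 : F 0 = 0 := by simp [hF]
  obtain ⟨h, hh, hu⟩ : ∃ h : ℝ, 0 < h ∧ IsUnit (h⁻¹ • F h) := by
    have h1 : Tendsto (fun u : ℝ => u⁻¹ • F u) (𝓝[≠] 0) (𝓝 1) := by
      have := hasDerivAt_iff_tendsto_slope.mp (hF' 0)
      rw [hM0] at this
      refine this.congr fun u => ?_
      simp [slope, hF0]
    have h2 : ∀ᶠ u in 𝓝[>] (0 : ℝ), IsUnit (u⁻¹ • F u) :=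
      (h1.mono_left (nhdsWithin_mono 0 fun x hx => ne_of_gt hx)).eventually
        (Units.isOpen.mem_nhds isUnit_one)
    obtain ⟨h, hu, hh⟩ := (h2.and self_mem_nhdsWithin).exists
    exact ⟨h, hh, hu⟩
  obtain ⟨V, hV⟩ : ∃ V, F h * V = 1 := by
    obtain ⟨W, hW⟩ := hu.exists_right_inv
    exact ⟨h⁻¹ • W, by rw [mul_smul_comm, ← smul_mul_assoc, hW]⟩
  have hshift : ∀ t : ℝ, 0 ≤ t → M t = (F (t + h) - F t) * V := by
    intro t ht
    have e : M t * F h = F (t + h) - F t := by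
      have e1 : M t * F h = ∫ x in (0 : ℝ)..h, M (x + t) := by
        rw [hF]
        simp only
        rw [← ContinuousLinearMap.mul_apply' ℂ A, ← ContinuousLinearMap.intervalIntegral_comp_comm _
          (hMc.intervalIntegrable _ _)]
        refine intervalIntegral.integral_congr fun x hx => ?_
        rw [Set.uIcc_of_le hh.le] at hx
        simp only [hM, ContinuousLinearMap.mul_apply']
        rw [← hadd, add_comm, Real.toNNReal_add hx.1 ht]
      rw [e1, intervalIntegral.integral_comp_add_right, hF]
      simp only
      rw [intervalIntegral.integral_interval_sub_left (hMc.intervalIntegrable _ _)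
        (hMc.intervalIntegrable _ _), zero_add, add_comm]
    rw [← e, mul_assoc, hV, mul_one]
  have hG : HasDerivAt (fun t => (F (t + h) - F t) * V) ((M (0 + h) - M 0) * V) 0 :=
    (((hF' (0 + h)).comp_add_const 0 h).sub (hF' 0)).mul_const V
  refine ⟨_, ((hasDerivAt_iff_tendsto_slope.mp hG).comp (f := fun t : ℝ≥0 => (t : ℝ))
    (x := 𝓝[>] 0) ?_).congr fun t => ?_⟩
  · refine tendsto_nhdsWithin_iff.mpr ⟨?_, ?_⟩
    · exact (NNReal.continuous_coe.tendsto' 0 0 rfl).mono_left nhdsWithin_le_nhds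
    · filter_upwards [self_mem_nhdsWithin] with t ht
      exact ne_of_gt (NNReal.coe_pos.mpr ht)
  · have h1 : (F ((t : ℝ) + h) - F t) * V = T t := by
      rw [← hshift t t.2, hM]
      simp
    have h2 : (F (0 + h) - F 0) * V = 1 := by rw [← hshift 0 le_rfl, hM0]
    simp only [Function.comp, slope, h1, h2, sub_zero, vsub_eq_sub]

/-- Cluster points at infinity of a semigroup form a semigroup. -/
theorem mapClusterPt_mul {A : Type*} [Monoid A] [TopologicalSpace A] [ContinuousMul A]
    {T : ℝ≥0 → A} (hadd : ∀ s t, T (s + t) = T s * T t) {a b : A}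
    (ha : MapClusterPt a atTop T) (hb : MapClusterPt b atTop T) :
    MapClusterPt (a * b) atTop T := by
  rw [mapClusterPt_iff_frequently] at ha hb ⊢
  intro U hU
  have h1 : ∀ᶠ p : A × A in 𝓝 a ×ˢ 𝓝 b, p.1 * p.2 ∈ U := by
    rw [← nhds_prod_eq]
    exact continuous_mul.tendsto (a, b) hU
  obtain ⟨V, hV, W, hW, hVW⟩ := mem_prod_iff.mp h1
  rw [frequently_atTop]
  intro N
  obtain ⟨s, hs, hsV⟩ := frequently_atTop.mp (ha V hV) N
  obtain ⟨t, -, htW⟩ := frequently_atTop.mp (hb W hW) 0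
  exact ⟨s + t, le_add_right hs, by rw [hadd]; exact hVW (Set.mk_mem_prod hsV htW)⟩

/-- A semigroup with values in a compact set has an idempotent cluster point at infinity, by the
Ellis–Numakura lemma. -/
theorem exists_idempotent_mapClusterPt {A : Type*} [Monoid A] [TopologicalSpace A] [T2Space A]
    [ContinuousMul A] {T : ℝ≥0 → A} (hadd : ∀ s t, T (s + t) = T s * T t) {K : Set A}
    (hK : IsCompact K) (hT : ∀ t, T t ∈ K) : ∃ e, MapClusterPt e atTop T ∧ e * e = e := by
  refine exists_idempotent_in_compact_subsemigroup (fun r => continuous_mul_const r)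
    {e | MapClusterPt e atTop T} ?_ ?_ fun x hx y hy => mapClusterPt_mul hadd hx hy
  · obtain ⟨e, -, he⟩ := hK.exists_mapClusterPt (f := atTop) (u := T)
      (le_principal_iff.mpr (Filter.mem_map.mpr (Eventually.of_forall hT)))
    exact ⟨e, he⟩
  · have hcl : IsClosed {e | MapClusterPt e atTop T} := isClosed_setOfPred_clusterPt
    refine hK.of_isClosed_subset hcl fun e he => ?_
    exact hK.isClosed.mem_of_mapClusterPt he (Eventually.of_forall hT)

variable {E : Type*} [NormedAddCommGroup E] [NormedSpace ℂ E] [FiniteDimensional ℂ E]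
  {T : ℝ≥0 → E →ₗ[ℂ] E}

theorem continuous_toContinuousLinearMap (hT : ∀ x, Continuous fun t => T t x) :
    Continuous fun t => LinearMap.toContinuousLinearMap (T t) :=
  continuous_clm_apply.mpr hT

theorem toContinuousLinearMap_add (hadd : ∀ s t, T (s + t) = T s ∘ₗ T t) (s t : ℝ≥0) :
    LinearMap.toContinuousLinearMap (T (s + t)) =
      LinearMap.toContinuousLinearMap (T s) * LinearMap.toContinuousLinearMap (T t) := by
  ext1 x
  simp [hadd]

theorem exists_linearMap_tendsto_generator (hT : ∀ x, Continuous fun t => T t x)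
    (h0 : T 0 = LinearMap.id) (hadd : ∀ s t, T (s + t) = T s ∘ₗ T t) :
    ∃ L : E →ₗ[ℂ] E,
      ∀ x, Tendsto (fun t : ℝ≥0 => (t : ℝ)⁻¹ • (T t x - x)) (𝓝[>] 0) (𝓝 (L x)) := by
  have : CompleteSpace E := FiniteDimensional.complete ℂ E
  obtain ⟨L, hL⟩ := exists_tendsto_generator (continuous_toContinuousLinearMap hT)
    (by ext1 x; simp [h0]) (toContinuousLinearMap_add hadd)
  exact ⟨L, fun x => ((ContinuousLinearMap.apply ℂ E x).continuous.tendsto L).comp hL⟩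

/-- A bounded semigroup converges along some filter at infinity to an idempotent. -/
theorem exists_idempotent_tendsto (hadd : ∀ s t, T (s + t) = T s ∘ₗ T t)
    (hb : ∀ x, ∃ C, ∀ t, ‖T t x‖ ≤ C) :
    ∃ (e : E →ₗ[ℂ] E) (l : Filter ℝ≥0), l.NeBot ∧ l ≤ atTop ∧ (∀ x, e (e x) = e x) ∧
      ∀ x, Tendsto (fun t => T t x) l (𝓝 (e x)) := by
  have : CompleteSpace E := FiniteDimensional.complete ℂ E
  have : FiniteDimensional ℂ (E →L[ℂ] E) :=
    LinearEquiv.finiteDimensional (LinearMap.toContinuousLinearMap (𝕜 := ℂ) (E := E) (F' := E))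
  have : ProperSpace (E →L[ℂ] E) := FiniteDimensional.proper ℂ _
  obtain ⟨C, hC⟩ := banach_steinhaus (g := fun t => LinearMap.toContinuousLinearMap (T t)) hb
  obtain ⟨e, he, hee⟩ := exists_idempotent_mapClusterPt (toContinuousLinearMap_add hadd)
    (isCompact_closedBall (0 : E →L[ℂ] E) C) (fun t => by simpa using hC t)
  obtain ⟨l, hl, hle⟩ := mapClusterPt_iff_ultrafilter.mp he
  exact ⟨e, l, inferInstance, hl, fun x => congrArg (fun f : E →L[ℂ] E => f x) hee,
    fun x => ((ContinuousLinearMap.apply ℂ E x).continuous.tendsto e).comp hle⟩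

theorem tendsto_atTop_zero_of_tendsto (hadd : ∀ s t, T (s + t) = T s ∘ₗ T t)
    (hb : ∀ x, ∃ C, ∀ t, ‖T t x‖ ≤ C) {l : Filter ℝ≥0} [l.NeBot] {x : E}
    (hx : Tendsto (fun t => T t x) l (𝓝 0)) : Tendsto (fun t => T t x) atTop (𝓝 0) := by
  have : CompleteSpace E := FiniteDimensional.complete ℂ E
  obtain ⟨C, hC⟩ := banach_steinhaus (g := fun t => LinearMap.toContinuousLinearMap (T t)) hb
  have hC0 : 0 ≤ C := (norm_nonneg _).trans (hC 0)
  rw [Metric.tendsto_atTop]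
  intro ε hε
  obtain ⟨s, hs⟩ :=
    (hx.eventually (Metric.ball_mem_nhds 0 (ε := ε / (C + 1)) (by positivity))).exists
  refine ⟨s, fun t ht => ?_⟩
  rw [dist_zero_right, lt_div_iff₀ (by positivity)] at hs
  have e : T t x = T (t - s) (T s x) := by
    rw [← LinearMap.comp_apply, ← hadd, tsub_add_cancel_of_le ht]
  have h2 := (LinearMap.toContinuousLinearMap (T (t - s))).le_of_opNorm_le (hC (t - s)) (T s x)
  rw [LinearMap.coe_toContinuousLinearMap', ← e] at h2
  rw [dist_zero_right]
  nlinarith [norm_nonneg (T s x)]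

/-- A vector annihilated by the generator is fixed by the semigroup. -/
theorem eq_of_tendsto_generator_zero (hT : ∀ x, Continuous fun t => T t x)
    (h0 : T 0 = LinearMap.id) (hadd : ∀ s t, T (s + t) = T s ∘ₗ T t) {x : E}
    (hx : Tendsto (fun t : ℝ≥0 => (t : ℝ)⁻¹ • (T t x - x)) (𝓝[>] 0) (𝓝 0)) (t : ℝ≥0) :
    T t x = x := by
  have h := constant_of_has_deriv_right_zero (f := fun r : ℝ => T r.toNNReal x) (a := 0) (b := t)
    ((hT x).comp continuous_real_toNNReal).continuousOn (fun r hr => ?_) t ⟨t.2, le_rfl⟩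
  · simpa [h0] using h
  · rw [← hasDerivWithinAt_Ioi_iff_Ici, hasDerivWithinAt_iff_tendsto_slope' Set.self_notMem_Ioi]
    have h1 : Tendsto (fun u : ℝ => (u - r).toNNReal) (𝓝[>] r) (𝓝[>] 0) := by
      refine tendsto_nhdsWithin_iff.mpr ⟨?_, ?_⟩
      · refine (Continuous.tendsto' (by fun_prop) r 0 (by simp)).mono_left nhdsWithin_le_nhds
      · filter_upwards [self_mem_nhdsWithin] with u hu
        exact Real.toNNReal_pos.mpr (sub_pos.mpr hu)
    have h2 := ((LinearMap.toContinuousLinearMap (T r.toNNReal)).continuous.tendsto 0).comp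
      (hx.comp h1)
    rw [map_zero] at h2
    refine h2.congr' ?_
    filter_upwards [self_mem_nhdsWithin] with u hu
    have hu' : 0 ≤ u - r := (sub_pos.mpr hu).le
    have e : u.toNNReal = r.toNNReal + (u - r).toNNReal := by
      rw [← Real.toNNReal_add hr.1 hu', add_sub_cancel]
    simp only [Function.comp, LinearMap.coe_toContinuousLinearMap', slope, vsub_eq_sub, e, hadd,
      LinearMap.comp_apply, Real.coe_toNNReal _ hu', map_sub, LinearMap.map_smul_of_tower]

end Semigroup

end QuantumSemigroup

namespace QMS

variable {n : Type*} [Fintype n] [DecidableEq n]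

section Norm

-- Any norm inducing the product topology would do.

attribute [local instance] Matrix.normedAddCommGroup Matrix.normedSpace

theorem exists_tendsto_lindbladian (P : QMS n) : ∃ L : Matrix n n ℂ →ₗ[ℂ] Matrix n n ℂ,
    ∀ X, Tendsto (fun t : ℝ≥0 => (t : ℝ)⁻¹ • (P.map t X - X)) (𝓝[>] 0) (𝓝 (L X)) :=
  exists_linearMap_tendsto_generator P.continuous P.map_zero P.map_add

theorem map_eq_self_of_tendsto_zero (P : QMS n) {X : Matrix n n ℂ}
    (hX : Tendsto (fun t : ℝ≥0 => (t : ℝ)⁻¹ • (P.map t X - X)) (𝓝[>] 0) (𝓝 0)) (t : ℝ≥0) :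
    P.map t X = X :=
  eq_of_tendsto_generator_zero P.continuous P.map_zero P.map_add hX t

/-- By the Kadison–Schwarz inequality the diagonal of `P_t(X)^* P_t(X)` is bounded by any `c` with
`X^* X ≤ c`. -/
theorem exists_norm_map_le (P : QMS n) (X : Matrix n n ℂ) : ∃ C, ∀ t, ‖P.map t X‖ ≤ C := by
  obtain ⟨c, hc⟩ := exists_smul_one_sub_posSemidef (Matrix.isHermitian_conjTranspose_mul_self X)
  refine ⟨√c, fun t => (Matrix.norm_le_iff (Real.sqrt_nonneg c)).mpr fun i j => ?_⟩
  obtain ⟨B, hB⟩ := PosSemidef.exists_conjTranspose_mul_self hc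
  have h1 := (P.completelyPositive t).posSemidef_map B
  rw [← hB, map_sub, map_smul, P.map_one] at h1
  have h2 := (P.completelyPositive t).kadison_schwarz (P.map_one t) X
  have h3 := (h1.add h2).diag_nonneg (i := j)
  refine Real.le_sqrt_of_sq_le ?_
  have h4 := (Complex.le_def.mp h3).1
  simp only [Matrix.add_apply, Matrix.sub_apply, Matrix.smul_apply, Matrix.one_apply_eq,
    Matrix.mul_apply, Matrix.conjTranspose_apply, Complex.add_re, Complex.sub_re, smul_eq_mul,
    mul_one, Complex.ofReal_re, Complex.re_sum, Complex.zero_re] at h4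
  have h5 : ∀ x, (star (P.map t X x j) * P.map t X x j).re = ‖P.map t X x j‖ ^ 2 := fun x => by
    rw [Complex.star_def, Complex.conj_mul', ← Complex.ofReal_pow, Complex.ofReal_re]
  simp only [h5] at h4
  have h6 := Finset.single_le_sum (f := fun x => ‖P.map t X x j‖ ^ 2)
    (fun _ _ => by positivity) (Finset.mem_univ i)
  linarith

theorem exists_idempotent_tendsto (P : QMS n) :
    ∃ (E : Matrix n n ℂ →ₗ[ℂ] Matrix n n ℂ) (l : Filter ℝ≥0), l.NeBot ∧ l ≤ atTop ∧
      (∀ X, E (E X) = E X) ∧ ∀ X, Tendsto (fun t => P.map t X) l (𝓝 (E X)) :=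
  QuantumSemigroup.exists_idempotent_tendsto P.map_add P.exists_norm_map_le

theorem tendsto_zero_of_tendsto (P : QMS n) {l : Filter ℝ≥0} [l.NeBot] {X : Matrix n n ℂ}
    (hX : Tendsto (fun t => P.map t X) l (𝓝 0)) : Tendsto (fun t => P.map t X) atTop (𝓝 0) :=
  tendsto_atTop_zero_of_tendsto P.map_add P.exists_norm_map_le hX

end Norm

variable (P : QMS n)

/-! ### The decoherence-free algebra -/

/-- The semigroup contracts the scalar product `Tr[σ X^* Y]`. -/
theorem trace_map_conjTranspose_mul_map_le {σ : Matrix n n ℂ} (hσ : P.IsFaithfulInvariantState σ)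
    (t : ℝ≥0) (X : Matrix n n ℂ) :
    (σ * ((P.map t X)ᴴ * P.map t X)).trace ≤ (σ * (Xᴴ * X)).trace := by
  obtain ⟨B, hB⟩ := PosSemidef.exists_conjTranspose_mul_self
    ((P.completelyPositive t).kadison_schwarz (P.map_one t) X)
  have h := PosDef.trace_mul_conjTranspose_mul_nonneg hσ.posDef B
  rw [← hB, mul_sub, Matrix.trace_sub, hσ.invariant, sub_nonneg] at h
  exact h

/-- A vector at which `P_t` is isometric gives equality in the Kadison–Schwarz inequality. -/
theorem map_conjTranspose_mul_self_of_trace_eq {σ : Matrix n n ℂ}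
    (hσ : P.IsFaithfulInvariantState σ) {t : ℝ≥0} {X : Matrix n n ℂ}
    (h : (σ * ((P.map t X)ᴴ * P.map t X)).trace = (σ * (Xᴴ * X)).trace) :
    P.map t (Xᴴ * X) = (P.map t X)ᴴ * P.map t X := by
  obtain ⟨B, hB⟩ := PosSemidef.exists_conjTranspose_mul_self
    ((P.completelyPositive t).kadison_schwarz (P.map_one t) X)
  have h0 : (σ * (Bᴴ * B)).trace = 0 := by
    rw [← hB, mul_sub, Matrix.trace_sub, hσ.invariant, h, sub_self]
  rw [PosDef.trace_mul_conjTranspose_mul_eq_zero hσ.posDef h0, mul_zero, sub_eq_zero] at hB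
  exact hB

section Limit

variable {E : Matrix n n ℂ →ₗ[ℂ] Matrix n n ℂ} {l : Filter ℝ≥0} [l.NeBot]

theorem map_conjTranspose (t : ℝ≥0) (X : Matrix n n ℂ) : P.map t Xᴴ = (P.map t X)ᴴ :=
  (P.completelyPositive t).map_conjTranspose X

/-- A fixed point of the limiting projection is recurrent, so that the decreasing quantity
`Tr[σ P_t(X)^* P_t(X)]` is constant along its orbit. -/
theorem trace_map_eq_of_limit {σ : Matrix n n ℂ} (hσ : P.IsFaithfulInvariantState σ)
    (hl : l ≤ atTop) (hE : ∀ X, Tendsto (fun t => P.map t X) l (𝓝 (E X))) {X : Matrix n n ℂ}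
    (hX : E X = X) (t : ℝ≥0) :
    (σ * ((P.map t X)ᴴ * P.map t X)).trace = (σ * (Xᴴ * X)).trace := by
  refine le_antisymm (P.trace_map_conjTranspose_mul_map_le hσ t X) ?_
  have hc : Continuous fun Y : Matrix n n ℂ => (σ * (Yᴴ * Y)).trace := by fun_prop
  have h1 := (hc.tendsto (E X)).comp (hE X)
  rw [hX] at h1
  refine le_of_tendsto h1 (Filter.Eventually.mono (hl (eventually_ge_atTop t)) fun s hs => ?_)
  have e : P.map s X = P.map (s - t) (P.map t X) := by
    rw [← LinearMap.comp_apply, ← P.map_add, tsub_add_cancel_of_le hs]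
  simp only [Function.comp, e]
  exact P.trace_map_conjTranspose_mul_map_le hσ (s - t) _

theorem mem_dfAlgebra_of_limit {σ : Matrix n n ℂ} (hσ : P.IsFaithfulInvariantState σ)
    (hl : l ≤ atTop) (hE : ∀ X, Tendsto (fun t => P.map t X) l (𝓝 (E X))) {X : Matrix n n ℂ}
    (hX : E X = X) : X ∈ P.dfAlgebra := by
  intro t Y
  have hX' : E Xᴴ = Xᴴ := by
    refine tendsto_nhds_unique (hE Xᴴ) ?_
    simp only [P.map_conjTranspose]
    have := (continuous_id.matrix_conjTranspose.tendsto (E X)).comp (hE X)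
    rwa [hX] at this
  have h1 := P.map_conjTranspose_mul_self_of_trace_eq hσ (P.trace_map_eq_of_limit hσ hl hE hX t)
  have h2 := P.map_conjTranspose_mul_self_of_trace_eq hσ (P.trace_map_eq_of_limit hσ hl hE hX' t)
  refine ⟨(P.completelyPositive t).map_mul_of_eq (P.map_one t) h1 Y, ?_⟩
  have h3 := (P.completelyPositive t).map_mul_of_eq (P.map_one t) h2 Yᴴ
  have h4 := congrArg Matrix.conjTranspose h3
  simpa [← P.map_conjTranspose] using h4

/-- An idempotent limit point of the semigroup is the conditional expectation onto the
decoherence-free algebra. -/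
theorem isDFExpectation_of_limit {σ : Matrix n n ℂ} (hσ : P.IsFaithfulInvariantState σ)
    (hl : l ≤ atTop) (hE : ∀ X, Tendsto (fun t => P.map t X) l (𝓝 (E X)))
    (hEE : ∀ X, E (E X) = E X) : P.IsDFExpectation E := by
  have hker : ∀ X, E X = 0 ↔ Tendsto (fun t => P.map t X) atTop (𝓝 0) := fun X =>
    ⟨fun h => P.tendsto_zero_of_tendsto (l := l) (h ▸ hE X),
      fun h => tendsto_nhds_unique (hE X) (h.mono_left hl)⟩
  refine ⟨fun k M hM => ?_, hEE, ?_, fun τ hτ X => ?_, hker⟩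
  · have hc : Tendsto (fun t => Matrix.comp (Fin k) (Fin k) n n ℂ (M.map (P.map t))) l
        (𝓝 (Matrix.comp (Fin k) (Fin k) n n ℂ (M.map E))) := by
      refine tendsto_pi_nhds.mpr fun p => tendsto_pi_nhds.mpr fun q => ?_
      exact tendsto_pi_nhds.mp (tendsto_pi_nhds.mp (hE (M p.1 q.1)) p.2) q.2
    refine Matrix.PosSemidef.of_dotProduct_mulVec_nonneg ?_ fun v => ?_
    · refine tendsto_nhds_unique ((continuous_id.matrix_conjTranspose.tendsto _).comp hc) ?_
      refine hc.congr fun t => ?_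
      exact ((P.completelyPositive t k M hM).isHermitian).symm
    · have hv : Continuous fun A : Matrix (Fin k × n) (Fin k × n) ℂ => star v ⬝ᵥ (A *ᵥ v) := by
        fun_prop
      exact ge_of_tendsto' ((hv.tendsto _).comp hc) fun t =>
        (P.completelyPositive t k M hM).dotProduct_mulVec_nonneg v
  · ext X
    refine ⟨?_, fun hX => ⟨X, ?_⟩⟩
    · rintro ⟨Y, rfl⟩
      exact P.mem_dfAlgebra_of_limit hσ hl hE (hEE Y)
    · have hEX := P.mem_dfAlgebra_of_limit hσ hl hE (hEE X)
      have h0 : E (X - E X) = 0 := by rw [map_sub, hEE, sub_self]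
      have hlim := (hker _).mp h0
      -- The decoherence-free algebra is a subspace, on which the semigroup is isometric.
      have hiso : ∀ t, (σ * ((P.map t (X - E X))ᴴ * P.map t (X - E X))).trace =
          (σ * ((X - E X)ᴴ * (X - E X))).trace := by
        intro t
        rw [← hσ.invariant t ((X - E X)ᴴ * (X - E X))]
        congr 2
        simp only [Matrix.conjTranspose_sub, sub_mul, map_sub, (hX t _).1, (hEX t _).1, mul_sub]
      have hc : Continuous fun Y : Matrix n n ℂ => (σ * (Yᴴ * Y)).trace := by fun_prop
      have h1 := (hc.tendsto 0).comp hlim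
      simp only [Function.comp_def, hiso] at h1
      have h2 := tendsto_nhds_unique h1 tendsto_const_nhds
      have h3 := PosDef.trace_mul_conjTranspose_mul_eq_zero hσ.posDef
        (X := X - E X) (by simpa using h2.symm)
      exact (sub_eq_zero.mp h3).symm
  · have hc : Continuous fun Y : Matrix n n ℂ => (τ * Y).trace := by fun_prop
    refine tendsto_nhds_unique ((hc.tendsto _).comp (hE X)) ?_
    simp only [Function.comp_def, hτ.invariant]
    exact tendsto_const_nhds

end Limit

theorem exists_isDFExpectation {σ : Matrix n n ℂ} (hσ : P.IsFaithfulInvariantState σ) :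
    ∃ E, P.IsDFExpectation E := by
  obtain ⟨E, l, _, hl, hEE, hE⟩ := P.exists_idempotent_tendsto
  exact ⟨E, P.isDFExpectation_of_limit hσ hl hE hEE⟩

theorem isDFExpectation_dfExpectation {σ : Matrix n n ℂ} (hσ : P.IsFaithfulInvariantState σ) :
    P.IsDFExpectation P.dfExpectation := by
  rw [dfExpectation, dif_pos (P.exists_isDFExpectation hσ)]
  exact (P.exists_isDFExpectation hσ).choose_spec

/-- The conditional expectation is a limit point of the semigroup at infinity. -/
theorem exists_tendsto_dfExpectation {σ : Matrix n n ℂ} (hσ : P.IsFaithfulInvariantState σ) :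
    ∃ l : Filter ℝ≥0, l.NeBot ∧ ∀ X, Tendsto (fun t => P.map t X) l (𝓝 (P.dfExpectation X)) := by
  obtain ⟨E, l, hne, hl, hEE, hE⟩ := P.exists_idempotent_tendsto
  refine ⟨l, hne, ?_⟩
  rwa [(P.isDFExpectation_dfExpectation hσ).unique (P.isDFExpectation_of_limit hσ hl hE hEE)]

end QMS

namespace QuantumSemigroup

variable {n : Type*} [Fintype n] [DecidableEq n]

/-! ### Matrix powers and the modular group -/

theorem mpow_conjTranspose (A : Matrix n n ℂ) (r : ℝ) : (mpow A r)ᴴ = mpow A r :=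
  (cfc_predicate (fun x : ℝ => x ^ r) A : IsSelfAdjoint _)

theorem mpow_zero {A : Matrix n n ℂ} (hA : A.IsHermitian) : mpow A 0 = 1 := by
  simp [mpow, cfc_const_one ℝ A hA.isSelfAdjoint]

theorem mpow_one {A : Matrix n n ℂ} (hA : A.IsHermitian) : mpow A 1 = A := by
  simp [mpow, cfc_id' ℝ A hA.isSelfAdjoint]

theorem mpow_mul_mpow {A : Matrix n n ℂ} (hA : A.PosDef) (x y : ℝ) :
    mpow A x * mpow A y = mpow A (x + y) := by
  obtain ⟨Q, hQ, hf⟩ := exists_isResolution hA.isHermitian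
  simp only [mpow, hf, hQ.sum_smul_mul_sum_smul, ← Complex.ofReal_mul,
    Real.rpow_add (hA.eigenvalues_pos _)]

theorem mpow_half_mul_self {A : Matrix n n ℂ} (hA : A.PosSemidef) :
    mpow A (1 / 2) * mpow A (1 / 2) = A := by
  obtain ⟨Q, hQ, hf⟩ := exists_isResolution hA.isHermitian
  conv_rhs => rw [← mpow_one hA.isHermitian]
  simp only [mpow, hf, hQ.sum_smul_mul_sum_smul, ← Complex.ofReal_mul, Real.rpow_one,
    ← Real.sqrt_eq_rpow, Real.mul_self_sqrt (hA.eigenvalues_nonneg _)]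

/-- The projection onto the kernel of a hermitian matrix. -/
noncomputable def kernelProj (A : Matrix n n ℂ) : Matrix n n ℂ :=
  cfc (fun x : ℝ => if x = 0 then 1 else 0) A

theorem kernelProj_conjTranspose (A : Matrix n n ℂ) : (kernelProj A)ᴴ = kernelProj A :=
  (cfc_predicate (fun x : ℝ => if x = 0 then 1 else 0) A : IsSelfAdjoint _)

theorem kernelProj_mul_self {A : Matrix n n ℂ} (hA : A.IsHermitian) :
    kernelProj A * kernelProj A = kernelProj A := by
  obtain ⟨Q, hQ, hf⟩ := exists_isResolution hA
  simp only [kernelProj, hf, hQ.sum_smul_mul_sum_smul]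
  refine Finset.sum_congr rfl fun a _ => ?_
  by_cases h : hA.eigenvalues a = 0 <;> simp [h]

theorem mul_kernelProj {A : Matrix n n ℂ} (hA : A.IsHermitian) : A * kernelProj A = 0 := by
  obtain ⟨Q, hQ, hf⟩ := exists_isResolution hA
  conv_lhs => enter [1]; rw [← mpow_one hA]
  simp only [kernelProj, mpow, hf, hQ.sum_smul_mul_sum_smul]
  refine Finset.sum_eq_zero fun a _ => ?_
  by_cases h : hA.eigenvalues a = 0 <;> simp [h]

/-- The entropy production of a single step dominates four times its Dirichlet form, up to a
multiple of the mass that the step moves into the kernel of `ρ`. -/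
theorem exists_entropy_sub_dirichlet_le {σ ρ : Matrix n n ℂ} (hσ : σ.PosDef)
    (hρ : ρ.PosSemidef) : ∃ C : ℝ, ∀ Φ : Matrix n n ℂ →ₗ[ℂ] Matrix n n ℂ,
      IsGNSSymmetric σ Φ → IsCompletelyPositive Φ → Φ 1 = 1 →
      0 ≤ (ρ * (mlog ρ - mlog σ)).trace.re - (ρ * Φ (mlog ρ - mlog σ)).trace.re
        - 4 * ρ.trace.re
        + 4 * (mpow ρ (1 / 2) * Φ (mpow ρ (1 / 2) * mpow σ (-(1 / 2))) * mpow σ (1 / 2)).trace.re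
        + C * (ρ * Φ (kernelProj ρ)).trace.re := by
  obtain ⟨Q, hQ, hQf⟩ := exists_isResolution hσ.isHermitian
  obtain ⟨R, hR, hRf⟩ := exists_isResolution hρ.isHermitian
  set s := hσ.isHermitian.eigenvalues with hs
  set p := hρ.isHermitian.eigenvalues with hp
  have hpos : ∀ a, 0 < s a := hσ.eigenvalues_pos
  have hnn : ∀ k, 0 ≤ p k := hρ.eigenvalues_nonneg
  have hσQ : σ = ∑ a, (s a : ℂ) • Q a := by
    conv_lhs => rw [← mpow_one hσ.isHermitian]
    simp only [mpow, hQf, Real.rpow_one]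
  have hρR : ρ = ∑ a, (p a : ℂ) • R a := by
    conv_lhs => rw [← mpow_one hρ.isHermitian]
    simp only [mpow, hRf, Real.rpow_one]
  obtain ⟨C, hC⟩ : ∃ C : ℝ, ∀ k b d, 0 ≤ Real.log (p k) - Real.log (s b / s d) - 4 + C := by
    obtain ⟨C, hC⟩ := (Set.finite_range fun q : n × n × n =>
      -(Real.log (p q.1) - Real.log (s q.2.1 / s q.2.2) - 4)).bddAbove
    refine ⟨C, fun k b d => ?_⟩
    have := hC (Set.mem_range_self (k, b, d))
    simp only at this
    linarith
  refine ⟨C, fun Φ hsym hΦ h1 => ?_⟩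
  have h := entropy_sub_dirichlet_le hQ hR (hσQ ▸ hsym) hΦ h1 hpos hnn hC
  have e1 : mlog ρ = ∑ k, (Real.log (p k) : ℂ) • R k := hRf _
  have e2 : mlog σ = ∑ k, (Real.log (s k) : ℂ) • Q k := hQf _
  have e3 : mpow ρ (1 / 2) = ∑ k, (√(p k) : ℂ) • R k := by
    simp only [mpow, hRf, Real.sqrt_eq_rpow]
  have e4 : mpow σ (1 / 2) = ∑ k, (√(s k) : ℂ) • Q k := by
    simp only [mpow, hQf, Real.sqrt_eq_rpow]
  have e5 : mpow σ (-(1 / 2)) = ∑ k, ((√(s k))⁻¹ : ℂ) • Q k := by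
    simp only [mpow, hQf, Real.sqrt_eq_rpow, Real.rpow_neg (hpos _).le, Complex.ofReal_inv]
  have e6 : kernelProj ρ = ∑ k, ((if p k = 0 then 1 else 0 : ℝ) : ℂ) • R k := hRf _
  rw [e1, e2, e3, e4, e5, e6, hρR]
  exact h

/-- Detailed balance makes `Φ` intertwine left and right multiplication by `σ`. -/
theorem IsGNSSymmetric.mul_map_eq {σ : Matrix n n ℂ} {Φ : Matrix n n ℂ →ₗ[ℂ] Matrix n n ℂ}
    (hs : IsGNSSymmetric σ Φ) {Z W : Matrix n n ℂ} (h : σ * Z = W * σ) : σ * Φ Z = Φ W * σ := by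
  refine Matrix.ext_iff_trace_mul_right.mpr fun X => ?_
  rw [← hs, h, Matrix.mul_assoc, Matrix.trace_mul_comm, ← hs, Matrix.mul_assoc,
    Matrix.trace_mul_comm, Matrix.mul_assoc, Matrix.trace_mul_comm]

/-- Detailed balance makes `Φ` commute with the modular group of `σ`. -/
theorem IsGNSSymmetric.map_mpow_mul_mul_mpow {σ : Matrix n n ℂ}
    {Φ : Matrix n n ℂ →ₗ[ℂ] Matrix n n ℂ} (hs : IsGNSSymmetric σ Φ) (hσ : σ.PosDef) (x : ℝ)
    (Y : Matrix n n ℂ) : Φ (mpow σ x * Y * mpow σ (-x)) = mpow σ x * Φ Y * mpow σ (-x) := by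
  obtain ⟨Q, hQ, hf⟩ := exists_isResolution hσ.isHermitian
  set s := hσ.isHermitian.eigenvalues
  have hpos : ∀ a, 0 < s a := hσ.eigenvalues_pos
  have hσQ : σ = ∑ a, (s a : ℂ) • Q a := by
    conv_lhs => rw [← mpow_one hσ.isHermitian]
    simp only [mpow, hf, Real.rpow_one]
  have key : ∀ a b c d, ((s c ^ x * s d ^ (-x) : ℝ) : ℂ) • (Q a * Φ (Q c * Y * Q d) * Q b) =
      ((s a ^ x * s b ^ (-x) : ℝ) : ℂ) • (Q a * Φ (Q c * Y * Q d) * Q b) := by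
    intro a b c d
    have h1 : σ * (Q c * Y * Q d) = ((s c / s d : ℝ) : ℂ) • (Q c * Y * Q d) * σ := by
      have hd : (s d : ℂ) ≠ 0 := by exact_mod_cast (hpos d).ne'
      rw [smul_mul_assoc, Matrix.mul_assoc (Q c * Y), hσQ, hQ.mul_sum_smul, ← Matrix.mul_assoc,
        ← Matrix.mul_assoc, hQ.sum_smul_mul, mul_smul_comm, smul_smul, smul_mul_assoc,
        smul_mul_assoc]
      congr 1
      push_cast
      field_simp
    have h2 := congrArg (fun Z => Q a * Z * Q b) (hs.mul_map_eq h1)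
    simp only [map_smul, smul_mul_assoc, mul_smul_comm] at h2
    rw [← Matrix.mul_assoc, ← Matrix.mul_assoc, Matrix.mul_assoc _ σ (Q b), hσQ,
      hQ.mul_sum_smul, hQ.sum_smul_mul] at h2
    simp only [smul_mul_assoc, mul_smul_comm, smul_smul, ← Complex.ofReal_mul] at h2
    by_cases hz : Q a * Φ (Q c * Y * Q d) * Q b = 0
    · rw [hz, smul_zero, smul_zero]
    · have h3 := Complex.ofReal_injective (smul_left_injective ℂ hz h2)
      have h4 : s a / s b = s c / s d := by
        rw [h3]
        have := (hpos b).ne'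
        field_simp
      rw [Real.rpow_neg (hpos d).le, Real.rpow_neg (hpos b).le, ← div_eq_mul_inv,
        ← div_eq_mul_inv, ← Real.div_rpow (hpos c).le (hpos d).le,
        ← Real.div_rpow (hpos a).le (hpos b).le, h4]
  have hl : Φ (mpow σ x * Y * mpow σ (-x)) = (∑ a, Q a) * Φ (mpow σ x * Y * mpow σ (-x)) *
      ∑ a, Q a := by simp [hQ.sum_eq_one]
  have hr : mpow σ x * Φ Y * mpow σ (-x) =
      mpow σ x * Φ ((∑ a, Q a) * Y * ∑ a, Q a) * mpow σ (-x) := by simp [hQ.sum_eq_one]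
  rw [hl, hr]
  simp only [mpow, hf]
  have e1 : (∑ a, Q a) * Φ ((∑ c, ((s c ^ x : ℝ) : ℂ) • Q c) * Y *
      ∑ d, ((s d ^ (-x) : ℝ) : ℂ) • Q d) * ∑ b, Q b =
      ∑ b, ∑ d, ∑ c, ∑ a,
        ((s c ^ x * s d ^ (-x) : ℝ) : ℂ) • (Q a * Φ (Q c * Y * Q d) * Q b) := by
    simp only [Finset.mul_sum, Finset.sum_mul, map_sum, smul_mul_assoc, mul_smul_comm, map_smul,
      smul_smul, Complex.ofReal_mul, mul_comm, Finset.smul_sum]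
  have e2 : (∑ a, ((s a ^ x : ℝ) : ℂ) • Q a) * Φ ((∑ c, Q c) * Y * ∑ d, Q d) *
      ∑ b, ((s b ^ (-x) : ℝ) : ℂ) • Q b =
      ∑ b, ∑ d, ∑ c, ∑ a,
        ((s a ^ x * s b ^ (-x) : ℝ) : ℂ) • (Q a * Φ (Q c * Y * Q d) * Q b) := by
    simp only [Finset.mul_sum, Finset.sum_mul, map_sum, smul_mul_assoc, mul_smul_comm,
      smul_smul, Complex.ofReal_mul, mul_comm, Finset.smul_sum]
  rw [e1, e2]
  exact Finset.sum_congr rfl fun b _ => Finset.sum_congr rfl fun d _ =>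
    Finset.sum_congr rfl fun c _ => Finset.sum_congr rfl fun a _ => key a b c d

end QuantumSemigroup

namespace QMS

variable {n : Type*} [Fintype n] [DecidableEq n] {P : QMS n}

/-! ### The generator under detailed balance -/

theorem exists_lindbladian_eq (P : QMS n) : ∃ L : Matrix n n ℂ →ₗ[ℂ] Matrix n n ℂ,
    (∀ X, P.lindbladian X = L X) ∧ (∀ X, P.lindbladianPredual X = predual L X) ∧
      ∀ X, Tendsto (fun t : ℝ≥0 => (t : ℝ)⁻¹ • (P.map t X - X)) (𝓝[>] 0) (𝓝 (L X)) := by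
  obtain ⟨L, hL⟩ := P.exists_tendsto_lindbladian
  refine ⟨L, fun X => (hL X).limUnder_eq, fun X => Tendsto.limUnder_eq ?_, hL⟩
  refine tendsto_pi_nhds.mpr fun i => tendsto_pi_nhds.mpr fun j => ?_
  have hc : Continuous fun Y : Matrix n n ℂ => (Y * X).trace := by fun_prop
  refine ((hc.tendsto _).comp (hL (Matrix.single j i 1))).congr fun t => ?_
  simp only [Function.comp, Matrix.smul_apply, Matrix.sub_apply, predual, LinearMap.coe_mk,
    AddHom.coe_mk, Matrix.of_apply, smul_mul_assoc, sub_mul, Matrix.trace_smul, Matrix.trace_sub]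
  rw [Matrix.trace_single_mul, one_smul]

theorem predual_eq_self_of_trace {Φ : Matrix n n ℂ →ₗ[ℂ] Matrix n n ℂ} {ρ : Matrix n n ℂ}
    (h : ∀ X, (Φ X * ρ).trace = (X * ρ).trace) : ρ = predual Φ ρ :=
  Matrix.ext_iff_trace_mul_left.mpr fun X => by rw [← trace_predual, h]

theorem mem_dfAlgebra_iff {σ : Matrix n n ℂ} (hσ : P.IsFaithfulInvariantState σ)
    {X : Matrix n n ℂ} : X ∈ P.dfAlgebra ↔ P.dfExpectation X = X := by
  have hE := P.isDFExpectation_dfExpectation hσ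
  rw [← hE.range_eq]
  exact ⟨by rintro ⟨Y, rfl⟩; exact hE.idempotent Y, fun h => ⟨X, h⟩⟩

theorem trace_sigmaTr_mul (P : QMS n) (X : Matrix n n ℂ) :
    (P.sigmaTr * X).trace = (Fintype.card n : ℂ)⁻¹ * (P.dfExpectation X).trace := by
  rw [sigmaTr, Matrix.trace_mul_comm, ← trace_predual]
  simp

theorem HasSigmaTrDBC.isGNSSymmetric (hP : P.HasSigmaTrDBC) (t : ℝ≥0) :
    IsGNSSymmetric P.sigmaTr (P.map t) := fun X Y => by
  simpa using hP.symm Xᴴ Y t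

/-- The reference state is faithful and invariant. -/
theorem HasSigmaTrDBC.isFaithfulInvariantState (hP : P.HasSigmaTrDBC) :
    P.IsFaithfulInvariantState P.sigmaTr := by
  obtain ⟨τ, hτ⟩ := hP.exists_faithful
  have hE := P.isDFExpectation_dfExpectation hτ
  have hne : Nonempty n := by
    by_contra hn
    rw [not_nonempty_iff] at hn
    simpa [Matrix.trace] using hτ.isState.trace_eq_one
  have hcard : (0 : ℂ) < (Fintype.card n : ℂ)⁻¹ := by
    have : (0 : ℝ) < (Fintype.card n : ℝ)⁻¹ := by
      have := Fintype.card_pos (α := n)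
      positivity
    rw [← Complex.ofReal_natCast, ← Complex.ofReal_inv]
    exact Complex.zero_lt_real.mpr this
  have hherm : P.sigmaTr.IsHermitian := by
    ext i j
    have h := hE.completelyPositive.map_conjTranspose (Matrix.single i j 1)
    simp only [Matrix.conjTranspose_single, star_one] at h
    simp [sigmaTr, predual, h]
  have hpos : P.sigmaTr.PosDef := by
    refine Matrix.PosDef.of_dotProduct_mulVec_pos hherm fun v hv => ?_
    have e : star v ⬝ᵥ (P.sigmaTr *ᵥ v) = (P.sigmaTr * Matrix.vecMulVec v (star v)).trace := by
      rw [Matrix.mul_vecMulVec, Matrix.trace_vecMulVec, dotProduct_comm]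
    obtain ⟨B, hB⟩ := PosSemidef.exists_conjTranspose_mul_self
      (Matrix.posSemidef_vecMulVec_self_star v)
    rw [e, trace_sigmaTr_mul, hB]
    have hps := hE.completelyPositive.posSemidef_map B
    refine mul_pos hcard (lt_of_le_of_ne hps.trace_nonneg fun h0 => hv ?_)
    have h1 := hps.trace_eq_zero_iff.mp h0.symm
    have h2 := hE.compatible τ hτ (Bᴴ * B)
    rw [h1, mul_zero, Matrix.trace_zero] at h2
    rw [PosDef.trace_mul_conjTranspose_mul_eq_zero hτ.posDef h2.symm, mul_zero] at hB
    funext i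
    simpa [Matrix.vecMulVec_apply] using congrFun (congrFun hB i) i
  have hone : P.dfExpectation 1 = 1 :=
    (mem_dfAlgebra_iff hτ).mp fun t Y => by simp [P.map_one]
  refine ⟨⟨hpos.posSemidef, ?_⟩, hpos, fun t X => ?_⟩
  · have h := P.trace_sigmaTr_mul 1
    rw [mul_one, hone, Matrix.trace_one] at h
    rw [h, inv_mul_cancel₀]
    exact_mod_cast Fintype.card_ne_zero
  · have h := hP.symm 1 X t
    simpa [P.map_one] using h

section Generator

variable {L : Matrix n n ℂ →ₗ[ℂ] Matrix n n ℂ}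

theorem generator_conjTranspose
    (hL : ∀ X, Tendsto (fun t : ℝ≥0 => (t : ℝ)⁻¹ • (P.map t X - X)) (𝓝[>] 0) (𝓝 (L X)))
    (X : Matrix n n ℂ) : L Xᴴ = (L X)ᴴ := by
  refine tendsto_nhds_unique (hL Xᴴ)
    (((continuous_id.matrix_conjTranspose.tendsto _).comp (hL X)).congr fun t => ?_)
  simp [P.map_conjTranspose, Matrix.conjTranspose_smul]

theorem HasSigmaTrDBC.isGNSSymmetric_generator (hP : P.HasSigmaTrDBC)
    (hL : ∀ X, Tendsto (fun t : ℝ≥0 => (t : ℝ)⁻¹ • (P.map t X - X)) (𝓝[>] 0) (𝓝 (L X))) :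
    IsGNSSymmetric P.sigmaTr L := by
  intro X Y
  have h1 : Continuous fun Z : Matrix n n ℂ => (P.sigmaTr * X * Z).trace := by fun_prop
  have h2 : Continuous fun Z : Matrix n n ℂ => (P.sigmaTr * Z * Y).trace := by fun_prop
  refine tendsto_nhds_unique ((h1.tendsto _).comp (hL Y))
    (((h2.tendsto _).comp (hL X)).congr fun t => ?_)
  simp only [Function.comp, mul_smul_comm, smul_mul_assoc, Matrix.trace_smul, mul_sub, sub_mul,
    Matrix.trace_sub, hP.isGNSSymmetric t X Y]

/-- Dissipativity of the generator for the scalar product `Tr[σ X^* Y]`. -/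
theorem trace_mul_generator_nonpos {σ : Matrix n n ℂ} (hσ : P.IsFaithfulInvariantState σ)
    (hL : ∀ X, Tendsto (fun t : ℝ≥0 => (t : ℝ)⁻¹ • (P.map t X - X)) (𝓝[>] 0) (𝓝 (L X)))
    (W : Matrix n n ℂ) : (σ * (Wᴴ * L W)).trace.re ≤ 0 := by
  have hc : Continuous fun Z : Matrix n n ℂ => (σ * (Wᴴ * Z)).trace.re := by fun_prop
  refine le_of_tendsto' ((hc.tendsto _).comp (hL W)) fun t => ?_
  have h1 := (Complex.le_def.mp (P.trace_map_conjTranspose_mul_map_le hσ t W)).1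
  have h2 := (Complex.le_def.mp
    (PosDef.trace_mul_conjTranspose_mul_nonneg hσ.posDef (P.map t W - W))).1
  have h3 : (σ * ((P.map t W)ᴴ * W)).trace.re = (σ * (Wᴴ * P.map t W)).trace.re := by
    have : (σ * ((P.map t W)ᴴ * W)).trace = star (σ * (Wᴴ * P.map t W)).trace := by
      rw [← Matrix.trace_conjTranspose, Matrix.conjTranspose_mul, hσ.posDef.isHermitian.eq,
        Matrix.trace_mul_comm]
      simp
    rw [this, Complex.star_def, Complex.conj_re]
  simp only [Matrix.conjTranspose_sub, sub_mul, mul_sub, Matrix.trace_sub, Complex.sub_re, h3,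
    Complex.zero_re] at h2
  simp only [Function.comp, mul_smul_comm, Matrix.trace_smul, mul_sub, Matrix.trace_sub,
    Complex.real_smul, Complex.re_ofReal_mul, Complex.sub_re]
  have h4 := mul_nonneg (inv_nonneg.mpr (NNReal.coe_nonneg t)) (show
    0 ≤ (σ * (Wᴴ * W)).trace.re - (σ * (Wᴴ * P.map t W)).trace.re by linarith)
  linarith

/-- The Dirichlet form vanishes only on the kernel of the generator: it is a nonnegative symmetric
form, so its derivative at a zero `W`, taken in the direction `L W`, vanishes. -/
theorem HasSigmaTrDBC.generator_eq_zero (hP : P.HasSigmaTrDBC)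
    (hL : ∀ X, Tendsto (fun t : ℝ≥0 => (t : ℝ)⁻¹ • (P.map t X - X)) (𝓝[>] 0) (𝓝 (L X)))
    {W : Matrix n n ℂ} (hW : (P.sigmaTr * (Wᴴ * L W)).trace.re = 0) : L W = 0 := by
  have hσ := hP.isFaithfulInvariantState
  set σ := P.sigmaTr
  set V := L W with hV
  have hsym : (σ * (Wᴴ * L V)).trace = (σ * (Vᴴ * V)).trace := by
    rw [← Matrix.mul_assoc, hP.isGNSSymmetric_generator hL, generator_conjTranspose hL,
      Matrix.mul_assoc]
  set a := (σ * (Vᴴ * V)).trace.re with ha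
  set b := (σ * (Vᴴ * L V)).trace.re with hb
  have key : ∀ r : ℝ, 2 * r * a + r ^ 2 * b ≤ 0 := by
    intro r
    have h := trace_mul_generator_nonpos hσ hL (W + (r : ℂ) • V)
    simp only [_root_.map_add, map_smul, Matrix.conjTranspose_add, Matrix.conjTranspose_smul,
      add_mul, mul_add, smul_mul_assoc, mul_smul_comm, Matrix.trace_add, Matrix.trace_smul,
      smul_eq_mul, Complex.star_def, Complex.conj_ofReal, Complex.add_re, Complex.re_ofReal_mul, hsym,
      ← hV, hW, ← ha, ← hb] at h
    linarith
  have ha0 := PosDef.trace_mul_conjTranspose_mul_nonneg hσ.posDef V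
  have ha0' := Complex.le_def.mp ha0
  have haz : a = 0 := by
    by_contra hne
    have hap : 0 < a := lt_of_le_of_ne ha0'.1 (Ne.symm hne)
    have h1 := key (a / (|b| + 1))
    have h2 : (a / (|b| + 1)) ^ 2 * |b| ≤ a / (|b| + 1) * a := by
      rw [sq, mul_assoc]
      refine mul_le_mul_of_nonneg_left ?_ (by positivity)
      rw [div_mul_eq_mul_div, div_le_iff₀ (by positivity)]
      nlinarith
    have h3 : 0 < a / (|b| + 1) * a := by positivity
    have h4 := mul_le_mul_of_nonneg_left (neg_abs_le b) (sq_nonneg (a / (|b| + 1)))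
    linarith
  exact PosDef.trace_mul_conjTranspose_mul_eq_zero hσ.posDef
    (Complex.ext haz ha0'.2.symm)

/-- The modular group carries `σ^{-1/4} ρ^{1/2} σ^{-1/4}` to `ρ^{1/2} σ^{-1/2}`. -/
theorem HasSigmaTrDBC.dirichletForm_relSqrt (hP : P.HasSigmaTrDBC)
    (hL : ∀ X, Tendsto (fun t : ℝ≥0 => (t : ℝ)⁻¹ • (P.map t X - X)) (𝓝[>] 0) (𝓝 (L X)))
    (hLeq : ∀ X, P.lindbladian X = L X) (ρ : Matrix n n ℂ) :
    P.dirichletForm (P.relSqrt ρ) =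
      -(mpow ρ (1 / 2) * L (mpow ρ (1 / 2) * mpow P.sigmaTr (-(1 / 2))) *
        mpow P.sigmaTr (1 / 2)).trace.re := by
  have hσ := hP.isFaithfulInvariantState.posDef
  set σ := P.sigmaTr with hσdef
  have hm : ∀ x y z, x + y = z → mpow σ x * mpow σ y = mpow σ z := fun x y z h => by
    rw [mpow_mul_mpow hσ, h]
  have e1 : mpow ρ (1 / 2) * mpow σ (-(1 / 2)) =
      mpow σ (1 / 4) * P.relSqrt ρ * mpow σ (-(1 / 4)) := by
    rw [relSqrt, ← hσdef, ← Matrix.mul_assoc, ← Matrix.mul_assoc,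
      hm (1 / 4) (-1 / 4) 0 (by norm_num), mpow_zero hσ.isHermitian, one_mul, Matrix.mul_assoc,
      hm _ _ (-(1 / 2)) (by norm_num)]
  have e2 : mpow σ (1 / 2) * (P.relSqrt ρ)ᴴ * mpow σ (1 / 2) =
      mpow σ (1 / 4) * mpow ρ (1 / 2) * mpow σ (1 / 4) := by
    rw [relSqrt, ← hσdef, Matrix.conjTranspose_mul, Matrix.conjTranspose_mul, mpow_conjTranspose,
      mpow_conjTranspose, ← Matrix.mul_assoc, ← Matrix.mul_assoc, hm _ _ (1 / 4) (by norm_num),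
      Matrix.mul_assoc _ (mpow σ (-1 / 4)), hm _ _ (1 / 4) (by norm_num)]
  rw [dirichletForm, ← hσdef, e2, hLeq, e1,
    (hP.isGNSSymmetric_generator hL).map_mpow_mul_mul_mpow hσ,
    Matrix.mul_assoc _ _ (mpow σ (1 / 2)), Matrix.mul_assoc _ _ (mpow σ (1 / 2)),
    hm _ _ (1 / 4) (by norm_num)]
  rw [← Matrix.mul_assoc, Matrix.trace_mul_comm _ (mpow σ (1 / 4))]
  simp only [Matrix.mul_assoc, ← hσdef]

/-- At `ρ^{1/2} σ^{-1/2}` the Dirichlet form is the one of the scalar product `Tr[σ X^* Y]`. -/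
theorem HasSigmaTrDBC.dirichletForm_relSqrt_eq (hP : P.HasSigmaTrDBC)
    (hL : ∀ X, Tendsto (fun t : ℝ≥0 => (t : ℝ)⁻¹ • (P.map t X - X)) (𝓝[>] 0) (𝓝 (L X)))
    (hLeq : ∀ X, P.lindbladian X = L X) (ρ : Matrix n n ℂ) :
    P.dirichletForm (P.relSqrt ρ) =
      -(P.sigmaTr * ((mpow ρ (1 / 2) * mpow P.sigmaTr (-(1 / 2)))ᴴ *
        L (mpow ρ (1 / 2) * mpow P.sigmaTr (-(1 / 2))))).trace.re := by
  have hσ := hP.isFaithfulInvariantState.posDef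
  rw [hP.dirichletForm_relSqrt hL hLeq, Matrix.conjTranspose_mul, mpow_conjTranspose,
    mpow_conjTranspose, ← Matrix.mul_assoc, ← Matrix.mul_assoc]
  nth_rw 3 [← mpow_one hσ.isHermitian]
  rw [mpow_mul_mpow hσ, Matrix.trace_mul_comm, ← Matrix.mul_assoc]
  norm_num

theorem HasSigmaTrDBC.dirichletForm_relSqrt_nonneg (hP : P.HasSigmaTrDBC) (ρ : Matrix n n ℂ) :
    0 ≤ P.dirichletForm (P.relSqrt ρ) := by
  obtain ⟨L, hLeq, -, hL⟩ := P.exists_lindbladian_eq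
  rw [hP.dirichletForm_relSqrt_eq hL hLeq, Left.nonneg_neg_iff]
  exact trace_mul_generator_nonpos hP.isFaithfulInvariantState hL _

end Generator

/-! ### Entropy production -/

theorem HasSigmaTrDBC.four_mul_dirichletForm_le (hP : P.HasSigmaTrDBC) {ρ : Matrix n n ℂ}
    (hρ : IsState ρ) :
    ((4 * P.dirichletForm (P.relSqrt ρ) : ℝ) : EReal) ≤ P.entropyProduction ρ := by
  rw [entropyProduction]
  split_ifs with hker
  swap
  · exact le_top
  rw [EReal.coe_le_coe_iff]
  obtain ⟨L, hLeq, hLp, hL⟩ := P.exists_lindbladian_eq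
  have hσ := hP.isFaithfulInvariantState.posDef
  set σ := P.sigmaTr with hσdef
  obtain ⟨C, hC⟩ := exists_entropy_sub_dirichlet_le hσ hρ.posSemidef
  set Y := mlog ρ - mlog σ with hY
  set W := mpow ρ (1 / 2) * mpow σ (-(1 / 2)) with hW
  have hWW : mpow ρ (1 / 2) * W * mpow σ (1 / 2) = ρ := by
    rw [hW, ← Matrix.mul_assoc, mpow_half_mul_self hρ.posSemidef, Matrix.mul_assoc,
      mpow_mul_mpow hσ, neg_add_cancel, mpow_zero hσ.isHermitian, mul_one]
  -- Finiteness of the entropy production says that no mass flows into the kernel of `ρ`.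
  have hρK : (ρ * L (kernelProj ρ)).trace.re = 0 := by
    have h0 : (ρ * L (kernelProj ρ)).trace =
        ((kernelProj ρ)ᴴ * P.lindbladianPredual ρ * kernelProj ρ).trace := by
      rw [Matrix.trace_mul_comm, trace_predual, ← hLp, kernelProj_conjTranspose,
        Matrix.trace_mul_cycle, kernelProj_mul_self hρ.posSemidef.isHermitian]
    rw [h0, trace_conjTranspose_mul_mul, Finset.sum_eq_zero, Complex.zero_re]
    intro c _
    refine hker _ ?_
    ext a
    exact congrFun (congrFun (mul_kernelProj hρ.posSemidef.isHermitian) a) c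
  have hlim : 0 ≤ -(ρ * L Y).trace.re + 4 * (mpow ρ (1 / 2) * L W * mpow σ (1 / 2)).trace.re +
      C * (ρ * L (kernelProj ρ)).trace.re := by
    have hc : Continuous fun Z : Matrix n n ℂ × Matrix n n ℂ × Matrix n n ℂ =>
        -(ρ * Z.1).trace.re + 4 * (mpow ρ (1 / 2) * Z.2.1 * mpow σ (1 / 2)).trace.re +
          C * (ρ * Z.2.2).trace.re := by fun_prop
    have ht := (hc.tendsto (L Y, L W, L (kernelProj ρ))).comp
      ((hL Y).prodMk_nhds ((hL W).prodMk_nhds (hL (kernelProj ρ))))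
    refine ge_of_tendsto' ht fun t => ?_
    have h := hC (P.map t) (hP.isGNSSymmetric t) (P.completelyPositive t) (P.map_one t)
    have h1 : (mpow ρ (1 / 2) * W * mpow σ (1 / 2)).trace.re = ρ.trace.re := by rw [hWW]
    have h2 : (ρ * kernelProj ρ).trace.re = 0 := by
      rw [mul_kernelProj hρ.posSemidef.isHermitian]
      simp
    simp only [Function.comp, mul_smul_comm, smul_mul_assoc, Matrix.trace_smul, mul_sub, sub_mul,
      Matrix.trace_sub, Complex.real_smul, Complex.re_ofReal_mul, Complex.sub_re, h1, h2]
    have h3 := mul_nonneg (inv_nonneg.mpr (NNReal.coe_nonneg t)) h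
    simp only [hY, hW] at h3 ⊢
    simp only [mul_sub, map_sub, Matrix.trace_sub, Complex.sub_re] at h3 ⊢
    linarith
  rw [hρK, mul_zero, add_zero] at hlim
  have hEP : (P.lindbladianPredual ρ * Y).trace = (ρ * L Y).trace := by
    rw [hLp, Matrix.trace_mul_comm, ← trace_predual, Matrix.trace_mul_comm]
  rw [hP.dirichletForm_relSqrt hL hLeq, ← hσdef, ← hW, hEP]
  linarith

/-- Under detailed balance the semigroup acts trivially on the decoherence-free algebra. -/
theorem HasSigmaTrDBC.map_eq_self (hP : P.HasSigmaTrDBC) {X : Matrix n n ℂ}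
    (hX : X ∈ P.dfAlgebra) (t : ℝ≥0) : P.map t X = X := by
  have hσ := hP.isFaithfulInvariantState
  have hiso : ∀ s, (P.sigmaTr * ((P.map s X)ᴴ * P.map s X)).trace =
      (P.sigmaTr * (Xᴴ * X)).trace := fun s => by
    rw [← (hX s X).1, hσ.invariant]
  set s := t / 2
  have hts : t = s + s := (add_halves t).symm
  have hcross : (P.sigmaTr * (Xᴴ * P.map t X)).trace = (P.sigmaTr * (Xᴴ * X)).trace := by
    rw [hts, P.map_add, LinearMap.comp_apply, ← Matrix.mul_assoc, hP.isGNSSymmetric s,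
      P.map_conjTranspose, Matrix.mul_assoc, hiso]
  have hcross' : (P.sigmaTr * ((P.map t X)ᴴ * X)).trace = (P.sigmaTr * (Xᴴ * X)).trace := by
    rw [← P.map_conjTranspose, ← Matrix.mul_assoc, ← hP.isGNSSymmetric t, Matrix.mul_assoc, hcross]
  refine sub_eq_zero.mp (PosDef.trace_mul_conjTranspose_mul_eq_zero hσ.posDef ?_)
  simp only [Matrix.conjTranspose_sub, sub_mul, mul_sub, Matrix.trace_sub, hiso, hcross, hcross',
    sub_self]

theorem HasSigmaTrDBC.entropyProduction_eq_zero_of_eq (hP : P.HasSigmaTrDBC) {ρ : Matrix n n ℂ}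
    (hρ : ρ = predual P.dfExpectation ρ) : P.entropyProduction ρ = 0 := by
  have hσ := hP.isFaithfulInvariantState
  obtain ⟨L, -, hLp, hL⟩ := P.exists_lindbladian_eq
  obtain ⟨l, _, hl⟩ := P.exists_tendsto_dfExpectation hσ
  have hE := P.isDFExpectation_dfExpectation hσ
  have htr : ∀ X, (P.dfExpectation X * ρ).trace = (X * ρ).trace := fun X => by
    rw [trace_predual, ← hρ]
  have hEP : ∀ t X, P.dfExpectation (P.map t X) = P.dfExpectation X := by
    intro t X
    have h : ∀ s, P.map s (P.map t X) = P.map t (P.map s X) := fun s => by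
      rw [← LinearMap.comp_apply, ← P.map_add, add_comm, P.map_add, LinearMap.comp_apply]
    have hfix := hP.map_eq_self ((mem_dfAlgebra_iff hσ).mpr (hE.idempotent X)) t
    have hcont : Continuous (P.map t) := LinearMap.continuous_of_finiteDimensional _
    have h1 := ((hcont.tendsto _).comp (hl X))
    rw [hfix] at h1
    exact tendsto_nhds_unique (hl (P.map t X)) (h1.congr fun s => (h s).symm)
  have hL0 : ∀ X, (L X * ρ).trace = 0 := by
    intro X
    have hc : Continuous fun Z : Matrix n n ℂ => (Z * ρ).trace := by fun_prop
    refine tendsto_nhds_unique ((hc.tendsto _).comp (hL X))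
      (tendsto_const_nhds.congr fun t => ?_)
    simp only [Function.comp, smul_mul_assoc, Matrix.trace_smul]
    rw [← htr (P.map t X - X), map_sub, hEP, sub_self]
    simp
  have hz : P.lindbladianPredual ρ = 0 := by
    rw [hLp]
    ext i j
    simpa [predual] using hL0 (Matrix.single j i 1)
  rw [entropyProduction, if_pos (by simp [hz]), hz]
  simp

theorem HasSigmaTrDBC.eq_of_entropyProduction_eq_zero (hP : P.HasSigmaTrDBC) {ρ : Matrix n n ℂ}
    (hρ : IsState ρ) (h0 : P.entropyProduction ρ = 0) : ρ = predual P.dfExpectation ρ := by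
  have hσ := hP.isFaithfulInvariantState
  obtain ⟨L, hLeq, -, hL⟩ := P.exists_lindbladian_eq
  obtain ⟨l, _, hl⟩ := P.exists_tendsto_dfExpectation hσ
  have hle := hP.four_mul_dirichletForm_le hρ
  rw [h0, ← EReal.coe_zero, EReal.coe_le_coe_iff] at hle
  have hD : P.dirichletForm (P.relSqrt ρ) = 0 :=
    le_antisymm (by linarith) (hP.dirichletForm_relSqrt_nonneg ρ)
  rw [hP.dirichletForm_relSqrt_eq hL hLeq, neg_eq_zero] at hD
  set σ := P.sigmaTr with hσdef
  set W := mpow ρ (1 / 2) * mpow σ (-(1 / 2)) with hW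
  have hLW := hP.generator_eq_zero hL hD
  have hfix : ∀ t, P.map t W = W := P.map_eq_self_of_tendsto_zero (hLW ▸ hL W)
  have hmem : W ∈ P.dfAlgebra := (mem_dfAlgebra_iff hσ).mpr
    (tendsto_nhds_unique (hl W) (by simp only [hfix]; exact tendsto_const_nhds))
  have hfix2 : ∀ t, P.map t (Wᴴ * W) = Wᴴ * W := fun t => by rw [(hmem t W).1, hfix]
  have hm : ∀ x y z, x + y = z → mpow σ x * mpow σ y = mpow σ z := fun x y z h => by
    rw [mpow_mul_mpow hσ.posDef, h]
  have hWs : W * mpow σ (1 / 2) = mpow ρ (1 / 2) := by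
    rw [hW, Matrix.mul_assoc, hm _ _ 0 (by norm_num), mpow_zero hσ.posDef.isHermitian, mul_one]
  -- With `Z = σ^{-1/2} W^* W σ^{1/2}` one has `ρ = σ Z`, and `Z` is fixed because `W^* W` is.
  set Z := mpow σ (-(1 / 2)) * (Wᴴ * W) * mpow σ (1 / 2) with hZ
  have hρZ : ρ = σ * Z := by
    have h1 : σ * mpow σ (-(1 / 2)) = mpow σ (1 / 2) := by
      conv_lhs => enter [1]; rw [← mpow_one hσ.posDef.isHermitian]
      exact hm _ _ _ (by norm_num)
    have h2 : mpow σ (1 / 2) * Wᴴ = mpow ρ (1 / 2) := by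
      have := congrArg Matrix.conjTranspose hWs
      rwa [Matrix.conjTranspose_mul, mpow_conjTranspose, mpow_conjTranspose] at this
    rw [hZ, ← Matrix.mul_assoc, ← Matrix.mul_assoc, h1, ← Matrix.mul_assoc, h2, Matrix.mul_assoc,
      hWs, mpow_half_mul_self hρ.posSemidef]
  have hZfix : ∀ t, P.map t Z = Z := fun t => by
    have h := (hP.isGNSSymmetric t).map_mpow_mul_mul_mpow hσ.posDef (-(1 / 2)) (Wᴴ * W)
    rwa [neg_neg, hfix2] at h
  have hinv : ∀ t X, (P.map t X * ρ).trace = (X * ρ).trace := fun t X => by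
    rw [Matrix.trace_mul_comm, hρZ, hP.isGNSSymmetric t, hZfix, Matrix.trace_mul_comm]
  refine predual_eq_self_of_trace fun X => ?_
  have hc : Continuous fun Y : Matrix n n ℂ => (Y * ρ).trace := by fun_prop
  refine tendsto_nhds_unique ((hc.tendsto _).comp (hl X)) ?_
  simp only [Function.comp_def, hinv]
  exact tendsto_const_nhds

end QMS

theorem corollary4p2 {n : Type*} [Fintype n] [DecidableEq n] (P : QMS n) (hP : P.HasSigmaTrDBC) :
    (∀ ρ : Matrix n n ℂ, QuantumSemigroup.IsState ρ →
      ((4 * P.dirichletForm (P.relSqrt ρ) : ℝ) : EReal) ≤ P.entropyProduction ρ) ∧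
    P.IsL1Regular ∧
    (∀ ρ : Matrix n n ℂ, QuantumSemigroup.IsState ρ →
      (P.entropyProduction ρ = 0 ↔ ρ = QuantumSemigroup.predual P.dfExpectation ρ)) := by
  refine ⟨fun ρ hρ => hP.four_mul_dirichletForm_le hρ, fun ρ hρ => ?_, fun ρ hρ =>
    ⟨hP.eq_of_entropyProduction_eq_zero hρ, hP.entropyProduction_eq_zero_of_eq⟩⟩
  refine le_trans ?_ (hP.four_mul_dirichletForm_le hρ)
  have := hP.dirichletForm_relSqrt_nonneg ρ
  exact EReal.coe_le_coe_iff.mpr (by linarith)
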